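/- Let $p\in[0,1]$ and $\beta\in[0,1]$. Let $X_1\sim\mathrm{Bernoulli}(p)$, $X_2\mid X_1=1\sim\mathrm{Bernoulli}(\tfrac12+\tfrac\beta2)$ and $X_2\mid X_1=0\sim\mathrm{Bernoulli}(\tfrac12-\tfrac\beta2)$, and let the data $\boldsymbol X$ consist of $N$ independent copies of $(X_1,X_2)$. Let $\mathcal G_1$ be the graph $X_1\to X_2$ and $\mathcal G_0$ the graph on $X_1,X_2$ without edge, with prior probabilities $q$ and $1-q$, where $0<q<1$. For a choice of marginal likelihoods $P(\boldsymbol X\mid\mathcal G_1)$, $P(\boldsymbol X\mid\mathcal G_0)$ let $P(\mathcal G_i\mid\boldsymbol X)$ be the posterior probabilities and consider the expected log posterior ratio per observation $$\frac1N\,\mathbb E\left[\log\frac{P(\mathcal G_1\mid\boldsymbol X)}{P(\mathcal G_0\mid\boldsymbol X)}\right],$$ where the expectation is over the true law of the data. (RAG) Denote this quantity by $r_{10}$ when the values $0,1$ are read as real numbers and the BGe score is used. That is, under $\mathcal G_1$ the rows of the data are modelled as independent bivariate normal vectors with mean $\mu$ and precision matrix $W$; the prior is $W\sim\mathrm{Wishart}(T^{-1},\alpha_w)$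 with $T=tI_2$, $t>0$, $\alpha_w>3$, and $\mu\mid W\sim N(0,(\alpha_\mu W)^{-1})$ with $\alpha_\mu>0$. Under $\mathcal G_0$ the two columns are modelled as independent, the $j$-th consisting of independent $N(\mu_j,(W^{-1})_{jj})$ variables, with the prior of $(\mu_j,(W^{-1})_{jj})$ inherited from the one above and the parameters of the two columns independent. Then, if $\beta<1$, $$\lim_{N\to\infty}r_{10}=\frac12\log\left(\frac{1-(2p-1)^2\beta^2}{1-\beta^2}\right),$$ and if $\beta=1$ and $0<p<1$, then $\lim_{N\to\infty}r_{10}=+\infty$. (DISC) Denote the same quantity by $\tilde r_{10}$ when the BDe score is used. That is, under $\mathcal G_1$ the probabilities of the cells $(1,1),(1,0),(0,1),(0,0)$ have a Dirichlet$(\alpha_1,\alpha_2,\alpha_3,\alpha_4)$ prior, all $\alpha_k>0$. Under $\mathcal G_0$ the variables are modelled as independent, with $\theta_1=P(X_1=1)$ and $\theta_2=P(X_2=1)$ a priori independent, $\theta_1\sim\mathrm{Beta}(\alpha_1+\alpha_2,\alpha_3+\alpha_4)$ and $\theta_2\sim\mathrm{Beta}(b_1,b_2)$ with arbitrary $b_1,b_2>0$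 (in particular for the law $\mathrm{Beta}(\alpha_1+\alpha_3,\alpha_2+\alpha_4)$ inherited from the Dirichlet prior, and for $\mathrm{Beta}(\alpha_1+\alpha_2,\alpha_3+\alpha_4)$). Then $$\lim_{N\to\infty}\tilde r_{10}=p_{11}\log\frac{p_{11}}{p_{1\cdot}p_{\cdot1}}+p_{10}\log\frac{p_{10}}{p_{1\cdot}p_{\cdot0}}+p_{01}\log\frac{p_{01}}{p_{0\cdot}p_{\cdot1}}+p_{00}\log\frac{p_{00}}{p_{0\cdot}p_{\cdot0}},$$ where $p_{11}=p(\tfrac12+\tfrac\beta2)$, $p_{10}=p(\tfrac12-\tfrac\beta2)$, $p_{01}=(1-p)(\tfrac12-\tfrac\beta2)$, $p_{00}=(1-p)(\tfrac12+\tfrac\beta2)$, $p_{1\cdot}=p_{11}+p_{10}$, $p_{0\cdot}=p_{01}+p_{00}$, $p_{\cdot1}=p_{11}+p_{01}$, $p_{\cdot0}=p_{10}+p_{00}$, and a term with $p_{ij}=0$ is read as $0$. -/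

import Mathlib

open MeasureTheory ProbabilityTheory Filter Topology
open scoped Matrix

noncomputable section

namespace TwoNode

/-! ### Sampling model: a binary parent with a binary child -/

/-- The conditional success probability of `X₂` given `X₁`:
`1/2 + β/2` if `X₁ = 1` and `1/2 - β/2` if `X₁ = 0`. -/
def childProb (β : unitInterval) (x₁ : Bool) : unitInterval :=
  if x₁ then ⟨1 / 2 + (β : ℝ) / 2, by constructor <;> linarith [β.2.1, β.2.2]⟩
  else ⟨1 / 2 - (β : ℝ) / 2, by constructor <;> linarith [β.2.1, β.2.2]⟩

/-- The joint law of `(X₁, X₂)`: `X₁` is Bernoulli(`p`), and given `X₁ = x₁` the variable `X₂` is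
Bernoulli(`childProb β x₁`).  The value `1` is `true`, the value `0` is `false`. -/
def sddLaw (p β : unitInterval) : Measure (Bool × Bool) :=
  (bernoulliMeasure true false p).compProd
    (Kernel.ofFunOfCountable fun x₁ => bernoulliMeasure true false (childProb β x₁))

/-! ### The evaluation criterion -/

/-- Posterior probability of the graph with an edge, when the two graphs have prior probabilities
`q` (edge) and `1 - q` (no edge) and marginal likelihoods `m₁` (edge) and `m₀` (no edge). -/
def posteriorEdge (q m₁ m₀ : ℝ) : ℝ := m₁ * q / (m₁ * q + m₀ * (1 - q))

/-- Posterior probability of the graph without edge, as for `posteriorEdge`. -/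
def posteriorEmpty (q m₁ m₀ : ℝ) : ℝ := m₀ * (1 - q) / (m₁ * q + m₀ * (1 - q))

/-- The expected log posterior ratio per observation,
`N⁻¹ · E[log (P(G₁ ∣ X) / P(G₀ ∣ X))]`, where `X` consists of `N` independent draws from `Q`, and
`L₁`, `L₀` are the marginal likelihoods of the two graphs. -/
def meanLogPosteriorRatio (Q : Measure (Bool × Bool)) (q : ℝ)
    (L₁ L₀ : ∀ N : ℕ, (Fin N → Bool × Bool) → ℝ) (N : ℕ) : ℝ :=
  (1 / (N : ℝ)) *
    ∫ x, Real.log (posteriorEdge q (L₁ N x) (L₀ N x) / posteriorEmpty q (L₁ N x) (L₀ N x))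
      ∂(Measure.pi fun _ : Fin N => Q)

/-! ### The Gaussian (BGe) score -/

/-- Density of the normal law on `ℝⁿ` with mean `m` and precision matrix `W`. -/
def normalPDF {n : ℕ} (m : Fin n → ℝ) (W : Matrix (Fin n) (Fin n) ℝ) (x : Fin n → ℝ) : ℝ :=
  W.det ^ (1 / 2 : ℝ) / (2 * Real.pi) ^ ((n : ℝ) / 2) *
    Real.exp (-(1 / 2) * ((x - m) ⬝ᵥ (W *ᵥ (x - m))))

/-- The multivariate gamma function `Γₙ(s) = π^(n(n-1)/4) ∏_{j=1}^n Γ(s + (1 - j)/2)`. -/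
def multiGamma (n : ℕ) (s : ℝ) : ℝ :=
  Real.pi ^ ((n : ℝ) * ((n : ℝ) - 1) / 4) * ∏ j : Fin n, Real.Gamma (s - (j : ℝ) / 2)

/-- Density at the positive definite matrix `W` of the Wishart law with `a` degrees of freedom and
scale matrix `T⁻¹`, with respect to Lebesgue measure on the entries on and above the diagonal. -/
def wishartPDF {n : ℕ} (T : Matrix (Fin n) (Fin n) ℝ) (a : ℝ) (W : Matrix (Fin n) (Fin n) ℝ) : ℝ :=
  W.det ^ ((a - n - 1) / 2) /
      ((2 : ℝ) ^ (a * n / 2) * multiGamma n (a / 2) / T.det ^ (a / 2)) *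
    Real.exp (-(1 / 2) * (T * W).trace)

/-- The symmetric `2 × 2` matrix with entries `w = (w₁₁, w₁₂, w₂₂)`. -/
def symMat (w : ℝ × ℝ × ℝ) : Matrix (Fin 2) (Fin 2) ℝ :=
  !![w.1, w.2.1; w.2.1, w.2.2]

/-- The integral of `f (μ, W)` against the normal-Wishart prior: `W` is Wishart with `aw` degrees
of freedom and parametric matrix `t • 1`, and `μ` given `W` is normal with mean `0` and
precision matrix `am • W`. -/
def normalWishartIntegral (am aw t : ℝ)
    (f : (Fin 2 → ℝ) → Matrix (Fin 2) (Fin 2) ℝ → ℝ) : ℝ :=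
  ∫ w in {w : ℝ × ℝ × ℝ | (symMat w).PosDef},
    (∫ μ : Fin 2 → ℝ, f μ (symMat w) * normalPDF 0 (am • symMat w) μ) *
      wishartPDF (t • (1 : Matrix (Fin 2) (Fin 2) ℝ)) aw (symMat w)

/-- BGe marginal likelihood of the complete graph: the rows are independent bivariate normal
vectors with mean `μ` and precision matrix `W`. -/
def bgeEdge (am aw t : ℝ) {N : ℕ} (x : Fin N → Fin 2 → ℝ) : ℝ :=
  normalWishartIntegral am aw t fun μ W => ∏ i, normalPDF μ W (x i)

/-- BGe marginal likelihood of the data of the single variable `j`: its observations are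
independent normal with mean `μ j` and variance the `j`-th diagonal entry of `W⁻¹`. -/
def bgeColumn (am aw t : ℝ) {N : ℕ} (j : Fin 2) (x : Fin N → Fin 2 → ℝ) : ℝ :=
  normalWishartIntegral am aw t fun μ W =>
    ∏ i, gaussianPDFReal (μ j) (Real.toNNReal (W⁻¹ j j)) (x i j)

/-- BGe marginal likelihood of the graph without edge: the two variables have independent
parameters, each with the prior it inherits from the complete graph. -/
def bgeEmpty (am aw t : ℝ) {N : ℕ} (x : Fin N → Fin 2 → ℝ) : ℝ :=
  bgeColumn am aw t 0 x * bgeColumn am aw t 1 x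

/-- Binary data, read as real vectors with entries `0` and `1`. -/
def asReal {N : ℕ} (x : Fin N → Bool × Bool) : Fin N → Fin 2 → ℝ :=
  fun i => ![if (x i).1 then 1 else 0, if (x i).2 then 1 else 0]

/-- Expected log posterior ratio per observation of the strategy that treats the binary variables
as Gaussian and uses the BGe score. -/
def ragRatio (p β : unitInterval) (q am aw t : ℝ) (N : ℕ) : ℝ :=
  meanLogPosteriorRatio (sddLaw p β) q
    (fun _ x => bgeEdge am aw t (asReal x)) (fun _ x => bgeEmpty am aw t (asReal x)) N

/-! ### The multinomial (BDe) score -/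

/-- The probability of a cell, for `θ = (θ₁₁, θ₁₀, θ₀₁)` the probabilities of the cells
`(1,1)`, `(1,0)`, `(0,1)`. -/
def cellProb (θ : ℝ × ℝ × ℝ) : Bool × Bool → ℝ
  | (true, true) => θ.1
  | (true, false) => θ.2.1
  | (false, true) => θ.2.2
  | (false, false) => 1 - θ.1 - θ.2.1 - θ.2.2

/-- Density of the Dirichlet law with parameters `a 0, a 1, a 2, a 3` at the cell probabilities
`θ₁₁, θ₁₀, θ₀₁, 1 - θ₁₁ - θ₁₀ - θ₀₁`. -/
def dirichletPDF (a : Fin 4 → ℝ) (θ : ℝ × ℝ × ℝ) : ℝ :=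
  1 / ((∏ k, Real.Gamma (a k)) / Real.Gamma (∑ k, a k)) *
    (cellProb θ (true, true) ^ (a 0 - 1) * cellProb θ (true, false) ^ (a 1 - 1) *
      cellProb θ (false, true) ^ (a 2 - 1) * cellProb θ (false, false) ^ (a 3 - 1))

/-- BDe marginal likelihood of the graph with an edge: the cell probabilities have a Dirichlet
prior with parameters `a`. -/
def bdeEdge (a : Fin 4 → ℝ) {N : ℕ} (x : Fin N → Bool × Bool) : ℝ :=
  ∫ θ in {θ : ℝ × ℝ × ℝ | ∀ c, 0 < cellProb θ c}, (∏ i, cellProb θ (x i)) * dirichletPDF a θ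

/-- The Bernoulli probability of `b` when the success probability is `s`. -/
def bernProb (s : ℝ) (b : Bool) : ℝ := if b then s else 1 - s

/-- BDe marginal likelihood of the graph without edge: `θ₁ = P(X₁ = 1)` and `θ₂ = P(X₂ = 1)` are
a priori independent; `θ₁` has the law Beta(`a 0 + a 1`, `a 2 + a 3`) that it has under the
Dirichlet prior, and `θ₂` has the law Beta(`b₁`, `b₂`). -/
def bdeEmpty (a : Fin 4 → ℝ) (b₁ b₂ : ℝ) {N : ℕ} (x : Fin N → Bool × Bool) : ℝ :=
  ∫ θ₁ : ℝ, ∫ θ₂ : ℝ, (∏ i, bernProb θ₁ (x i).1 * bernProb θ₂ (x i).2) *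
    (betaPDFReal (a 0 + a 1) (a 2 + a 3) θ₁ * betaPDFReal b₁ b₂ θ₂)

/-- Expected log posterior ratio per observation of the discretization strategy with the BDe score
(the data are already binary, so discretization leaves them unchanged). -/
def discRatio (p β : unitInterval) (q : ℝ) (a : Fin 4 → ℝ) (b₁ b₂ : ℝ) (N : ℕ) : ℝ :=
  meanLogPosteriorRatio (sddLaw p β) q
    (fun _ x => bdeEdge a x) (fun _ x => bdeEmpty a b₁ b₂ x) N

end TwoNode

end

namespace TwoNode

/-! ### Integrals of nonnegative functions -/

/-! Both scores have conjugate priors, so the log ratio of the marginal likelihoods has a closed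
form. It equals `N` times an explicit function of the empirical cell frequencies, up to an error of
order `log N` that is uniform over the data. Dividing by `N` removes this error and the prior odds.
What remains is the limit of the expectation of a function of the frequencies.

For BGe, let `R` be the posterior matrix with diagonal product `V` and determinant `D`, and put `s =
(aw + N) / 2`. Integrating out the mean and then the precision matrix gives a ratio of the form `C *
Γ(s) / Γ(s - 1/2) * V ^ (s - 1/2) / D ^ s` (`exists_bge_ratio`). For binary data `V` and `1 / D` are
bounded by fixed powers of `t + N` and `1 / t`, so the leading term is `N / 2 * log (V / D)`
(`exists_abs_log_bge_ratio_sub_le`). Here `V / D` is `1 / (1 - ρ²)` with `ρ` the regularized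
empirical correlation. The limit is therefore half the logarithm of this quantity at the true
correlation. It diverges when the two variables coincide without being constant.

For BDe the marginal likelihoods are products of Gamma values at shifted counts. The estimate `log
Γ(c + n) = n log n - n + O(log n)` (`abs_log_Gamma_sub_le`) does not see the shift `c` in its
leading part. The hyperparameters thus drop out and `N` times the empirical mutual information is
left (`exists_abs_log_bde_ratio_sub_le`).

The passage to expectations is `tendsto_integral_of_freq`. By Chebyshev the frequencies are far from
the true probabilities with probability `O(1/N)`, and this suffices because the functions involved
grow slower than `N`. Divergence follows by truncation. -/

lemma lintegral_exp_quadratic {b : ℝ} (hb : 0 < b) (c : ℝ) :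
    ∫⁻ x : ℝ, ENNReal.ofReal (Real.exp (-(b / 2) * x ^ 2 + c * x)) =
      ENNReal.ofReal (√(2 * Real.pi / b) * Real.exp (c ^ 2 / (2 * b))) := by
  have hv : (1 / b).toNNReal ≠ 0 := (Real.toNNReal_pos.2 (by positivity)).ne'
  have hc : (((1 / b).toNNReal : NNReal) : ℝ) = 1 / b := Real.coe_toNNReal _ (by positivity)
  -- Completing the square leaves a multiple of the normal density with mean `c / b` and variance `1
  -- / b`.
  have key : ∀ x : ℝ, ENNReal.ofReal (Real.exp (-(b / 2) * x ^ 2 + c * x)) =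
      ENNReal.ofReal (√(2 * Real.pi / b) * Real.exp (c ^ 2 / (2 * b))) *
        ENNReal.ofReal (gaussianPDFReal (c / b) (1 / b).toNNReal x) := by
    intro x
    rw [← ENNReal.ofReal_mul (by positivity), gaussianPDFReal_def]
    simp only [hc]
    congr 1
    have h2 : √(2 * Real.pi / b) ≠ 0 := by positivity
    rw [show 2 * Real.pi * (1 / b) = 2 * Real.pi / b by ring,
      show √(2 * Real.pi / b) * Real.exp (c ^ 2 / (2 * b)) *
      ((√(2 * Real.pi / b))⁻¹ * Real.exp (-(x - c / b) ^ 2 / (2 * (1 / b)))) =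
      Real.exp (c ^ 2 / (2 * b)) * Real.exp (-(x - c / b) ^ 2 / (2 * (1 / b))) by
        field_simp, ← Real.exp_add]
    congr 1
    field_simp
    ring
  simp_rw [key]
  rw [lintegral_const_mul _ (by fun_prop), lintegral_gaussianPDFReal_eq_one _ hv, mul_one]

lemma lintegral_rpow_mul_exp {u r : ℝ} (hu : 0 < u) (hr : 0 < r) :
    ∫⁻ h in Set.Ioi (0 : ℝ), ENNReal.ofReal (h ^ (u - 1) * Real.exp (-(r / 2) * h)) =
      ENNReal.ofReal (Real.Gamma u * (2 / r) ^ u) := by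
  rw [← ofReal_integral_eq_lintegral_ofReal]
  · congr 1
    have := Real.integral_rpow_mul_exp_neg_mul_Ioi hu (half_pos hr)
    simp only [neg_mul]
    rw [this, mul_comm]
    congr 2
    field_simp
  · have := integrableOn_rpow_mul_exp_neg_mul_rpow (s := u - 1) (p := 1) (b := r / 2)
      (by linarith) one_pos (half_pos hr)
    simpa [IntegrableOn] using this
  · refine ae_restrict_of_forall_mem measurableSet_Ioi fun x hx => ?_
    have : (0 : ℝ) < x := hx
    positivity

lemma measurableSet_posDef :
    MeasurableSet {w : ℝ × ℝ × ℝ | 0 < w.1 ∧ 0 < w.1 * w.2.2 - w.2.1 ^ 2} :=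
  by measurability

/-- Sylvester's criterion in order two, by completing the square in the first coordinate. It makes
the cone of positive definite matrices an explicit set of triples. -/
lemma symMat_posDef_iff (w : ℝ × ℝ × ℝ) :
    (symMat w).PosDef ↔ 0 < w.1 ∧ 0 < w.1 * w.2.2 - w.2.1 ^ 2 := by
  constructor
  · intro h
    refine ⟨by simpa [symMat] using h.diag_pos (i := 0), ?_⟩
    have := h.det_pos
    rw [symMat, Matrix.det_fin_two_of] at this
    nlinarith
  · rintro ⟨h1, h2⟩
    refine Matrix.PosDef.of_dotProduct_mulVec_pos ?_ ?_
    · ext i j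
      fin_cases i <;> fin_cases j <;> simp [symMat]
    · intro v hv
      have e : star v ⬝ᵥ (symMat w *ᵥ v) =
          ((w.1 * v 0 + w.2.1 * v 1) ^ 2 + (w.1 * w.2.2 - w.2.1 ^ 2) * v 1 ^ 2) / w.1 := by
        simp [symMat, Matrix.mulVec, dotProduct, Fin.sum_univ_two]
        field_simp
        ring
      rw [e]
      refine div_pos ?_ h1
      by_cases h : v 1 = 0
      · have h0 : v 0 ≠ 0 := by
          intro h0
          apply hv
          ext i
          fin_cases i <;> simp [h, h0]
        rw [h]
        have : 0 < (w.1 * v 0) ^ 2 := by positivity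
        simpa using this
      · have : 0 < v 1 ^ 2 := by positivity
        have := mul_pos h2 this
        nlinarith [sq_nonneg (w.1 * v 0 + w.2.1 * v 1)]

/-- The last entry is replaced by the Schur complement `h = w₂₂ - y² / x`. For fixed `x`, `y` this
is a translation, so there is no Jacobian. The cone becomes a product of two half-lines and a line,
and the determinant becomes `x * h`. -/
lemma lintegral_posDef {f : ℝ × ℝ × ℝ → ENNReal} (hf : Measurable f) :
    ∫⁻ w in {w : ℝ × ℝ × ℝ | 0 < w.1 ∧ 0 < w.1 * w.2.2 - w.2.1 ^ 2}, f w =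
      ∫⁻ x in Set.Ioi (0 : ℝ), ∫⁻ y : ℝ, ∫⁻ h in Set.Ioi (0 : ℝ), f (x, y, h + y ^ 2 / x) := by
  rw [← lintegral_indicator measurableSet_posDef, Measure.volume_eq_prod,
    lintegral_prod _ (hf.indicator measurableSet_posDef).aemeasurable,
    ← lintegral_indicator measurableSet_Ioi]
  refine lintegral_congr fun x => ?_
  rw [Measure.volume_eq_prod, lintegral_prod (fun z : ℝ × ℝ => Set.indicator
    {w : ℝ × ℝ × ℝ | 0 < w.1 ∧ 0 < w.1 * w.2.2 - w.2.1 ^ 2} f (x, z))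
    ((hf.indicator measurableSet_posDef).comp measurable_prodMk_left).aemeasurable]
  by_cases hx : 0 < x
  · rw [Set.indicator_of_mem (by exact hx)]
    refine lintegral_congr fun y => ?_
    rw [← lintegral_add_right_eq_self _ (y ^ 2 / x), ← lintegral_indicator measurableSet_Ioi]
    refine lintegral_congr fun h => ?_
    have : (x, y, h + y ^ 2 / x) ∈ {w : ℝ × ℝ × ℝ | 0 < w.1 ∧ 0 < w.1 * w.2.2 - w.2.1 ^ 2} ↔
        h ∈ Set.Ioi (0 : ℝ) := by
      simp only [Set.mem_ofPred_eq, Set.mem_Ioi, hx, true_and]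
      rw [show x * (h + y ^ 2 / x) - y ^ 2 = x * h by field_simp; ring]
      exact mul_pos_iff_of_pos_left hx
    by_cases hh : h ∈ Set.Ioi (0 : ℝ)
    · rw [Set.indicator_of_mem (this.2 hh), Set.indicator_of_mem hh]
    · rw [Set.indicator_of_notMem (mt this.1 hh), Set.indicator_of_notMem hh]
  · rw [Set.indicator_of_notMem (by exact hx)]
    simp [hx]

/-- The Schur complement coordinates single out one of the two variables; this symmetry transfers
the computation for the second variable to the first. -/
lemma lintegral_posDef_swap (f : ℝ × ℝ × ℝ → ENNReal) :
    ∫⁻ w in {w : ℝ × ℝ × ℝ | 0 < w.1 ∧ 0 < w.1 * w.2.2 - w.2.1 ^ 2}, f w =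
      ∫⁻ w in {w : ℝ × ℝ × ℝ | 0 < w.1 ∧ 0 < w.1 * w.2.2 - w.2.1 ^ 2},
        f (w.2.2, w.2.1, w.1) := by
  let e : ℝ × ℝ × ℝ ≃ᵐ ℝ × ℝ × ℝ :=
    (MeasurableEquiv.prodComm.trans
      (MeasurableEquiv.prodCongr MeasurableEquiv.prodComm (MeasurableEquiv.refl ℝ))).trans
      MeasurableEquiv.prodAssoc
  have he : MeasurePreserving e volume volume := by
    refine MeasurePreserving.trans (μb := (volume : Measure ((ℝ × ℝ) × ℝ))) ?_
      (volume_preserving_prodAssoc)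
    refine MeasurePreserving.trans (μb := (volume : Measure ((ℝ × ℝ) × ℝ))) 
      Measure.measurePreserving_swap ?_
    exact MeasurePreserving.prod Measure.measurePreserving_swap (MeasurePreserving.id volume)
  have := he.setLIntegral_comp_preimage_emb e.measurableEmbedding f
    {w : ℝ × ℝ × ℝ | 0 < w.1 ∧ 0 < w.1 * w.2.2 - w.2.1 ^ 2}
  rw [← this]
  have hs : e ⁻¹' {w : ℝ × ℝ × ℝ | 0 < w.1 ∧ 0 < w.1 * w.2.2 - w.2.1 ^ 2} =
      {w : ℝ × ℝ × ℝ | 0 < w.1 ∧ 0 < w.1 * w.2.2 - w.2.1 ^ 2} := by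
    ext ⟨x, y, z⟩
    show (0 < z ∧ 0 < z * x - y ^ 2) ↔ (0 < x ∧ 0 < x * z - y ^ 2)
    constructor
    · rintro ⟨h1, h2⟩
      refine ⟨?_, by linarith⟩
      by_contra h
      nlinarith [sq_nonneg y]
    · rintro ⟨h1, h2⟩
      refine ⟨?_, by linarith⟩
      by_contra h
      nlinarith [sq_nonneg y]
  rw [hs]
  rfl

/-- The integrals separate: `h` gives a Gamma integral, `y` a Gaussian one with precision `r₂ / x`,
and `x` a second Gamma integral. The Gaussian step contributes `√x`, hence `v + 1 / 2`, and lowers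
the rate `r₁` to `r₁ - r₁₂² / r₂`. The parameters `r₂` and `r₃` are kept apart because the data of a
single column affect only the coefficient of `h`. -/
lemma lintegral_normalWishart_kernel {u v r₁ r₂ r₃ r₁₂ : ℝ} (hu : 0 < u) (hv : 0 < v + 1 / 2)
    (h₂ : 0 < r₂) (h₃ : 0 < r₃) (hD : 0 < r₁ - r₁₂ ^ 2 / r₂) :
    ∫⁻ x in Set.Ioi (0 : ℝ), ∫⁻ y : ℝ, ∫⁻ h in Set.Ioi (0 : ℝ),
      ENNReal.ofReal (h ^ (u - 1) * x ^ (v - 1) *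
        Real.exp (-(1 / 2) * (r₁ * x + 2 * r₁₂ * y + r₂ * (y ^ 2 / x) + r₃ * h))) =
      ENNReal.ofReal (Real.Gamma u * (2 / r₃) ^ u * √(2 * Real.pi / r₂) *
        (Real.Gamma (v + 1 / 2) * (2 / (r₁ - r₁₂ ^ 2 / r₂)) ^ (v + 1 / 2))) := by
  have hG := Real.Gamma_pos_of_pos hu
  have step : ∀ x ∈ Set.Ioi (0 : ℝ), (∫⁻ y : ℝ, ∫⁻ h in Set.Ioi (0 : ℝ),
      ENNReal.ofReal (h ^ (u - 1) * x ^ (v - 1) *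
        Real.exp (-(1 / 2) * (r₁ * x + 2 * r₁₂ * y + r₂ * (y ^ 2 / x) + r₃ * h)))) =
      ENNReal.ofReal (Real.Gamma u * (2 / r₃) ^ u * √(2 * Real.pi / r₂)) *
        ENNReal.ofReal (x ^ (v + 1 / 2 - 1) *
          Real.exp (-((r₁ - r₁₂ ^ 2 / r₂) / 2) * x)) := by
    intro x hx
    have hx : (0 : ℝ) < x := hx
    have inner : ∀ y : ℝ, ∫⁻ h in Set.Ioi (0 : ℝ),
        ENNReal.ofReal (h ^ (u - 1) * x ^ (v - 1) *
          Real.exp (-(1 / 2) * (r₁ * x + 2 * r₁₂ * y + r₂ * (y ^ 2 / x) + r₃ * h))) =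
        ENNReal.ofReal (x ^ (v - 1) * Real.exp (-(r₁ / 2) * x) *
          (Real.Gamma u * (2 / r₃) ^ u)) *
          ENNReal.ofReal (Real.exp (-(r₂ / x / 2) * y ^ 2 + (-r₁₂) * y)) := by
      intro y
      have : ∀ h ∈ Set.Ioi (0 : ℝ), ENNReal.ofReal (h ^ (u - 1) * x ^ (v - 1) *
          Real.exp (-(1 / 2) * (r₁ * x + 2 * r₁₂ * y + r₂ * (y ^ 2 / x) + r₃ * h))) =
          ENNReal.ofReal (x ^ (v - 1) * Real.exp (-(r₁ / 2) * x) *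
            Real.exp (-(r₂ / x / 2) * y ^ 2 + (-r₁₂) * y)) *
            ENNReal.ofReal (h ^ (u - 1) * Real.exp (-(r₃ / 2) * h)) := by
        intro h _
        rw [← ENNReal.ofReal_mul (by positivity)]
        congr 1
        rw [show x ^ (v - 1) * Real.exp (-(r₁ / 2) * x) *
            Real.exp (-(r₂ / x / 2) * y ^ 2 + (-r₁₂) * y) *
            (h ^ (u - 1) * Real.exp (-(r₃ / 2) * h)) = h ^ (u - 1) * x ^ (v - 1) *
            (Real.exp (-(r₁ / 2) * x) * Real.exp (-(r₂ / x / 2) * y ^ 2 + (-r₁₂) * y) *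
              Real.exp (-(r₃ / 2) * h)) by ring, ← Real.exp_add, ← Real.exp_add]
        congr 2
        ring
      rw [setLIntegral_congr_fun measurableSet_Ioi this, lintegral_const_mul _ (by fun_prop),
        lintegral_rpow_mul_exp hu h₃, ← ENNReal.ofReal_mul (by positivity),
        ← ENNReal.ofReal_mul (by positivity)]
      congr 1
      ring
    simp_rw [inner]
    rw [lintegral_const_mul _ (by fun_prop), lintegral_exp_quadratic (by positivity),
      ← ENNReal.ofReal_mul (by positivity), ← ENNReal.ofReal_mul (by positivity)]
    congr 1
    rw [show 2 * Real.pi / (r₂ / x) = (2 * Real.pi / r₂) * x by field_simp,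
      Real.sqrt_mul (by positivity), Real.sqrt_eq_rpow x,
      show v + 1 / 2 - 1 = (v - 1) + 1 / 2 by ring, Real.rpow_add hx,
      show -((r₁ - r₁₂ ^ 2 / r₂) / 2) * x = -(r₁ / 2) * x + (-r₁₂) ^ 2 / (2 * (r₂ / x)) by
        field_simp; ring, Real.exp_add]
    ring
  rw [setLIntegral_congr_fun measurableSet_Ioi step, lintegral_const_mul _ (by fun_prop),
    lintegral_rpow_mul_exp hv hD, ← ENNReal.ofReal_mul (by positivity)]

/-- The integral of the exponential of a quadratic polynomial in two variables. -/
lemma integral_exp_quadratic_two {A B C : ℝ} (hC : 0 < C) (hD : 0 < A * C - B ^ 2) (c d : ℝ) :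
    ∫ m : Fin 2 → ℝ, Real.exp (-(1 / 2) * (A * m 0 ^ 2 + 2 * B * (m 0 * m 1) + C * m 1 ^ 2) +
        (c * m 0 + d * m 1)) =
      2 * Real.pi / √(A * C - B ^ 2) *
        Real.exp ((C * c ^ 2 - 2 * B * c * d + A * d ^ 2) / (2 * (A * C - B ^ 2))) := by
  rw [integral_eq_lintegral_of_nonneg_ae (ae_of_all _ fun _ => by positivity)
    (by fun_prop : Measurable _).aestronglyMeasurable]
  rw [← (volume_preserving_finTwoArrow ℝ).symm.lintegral_comp_emb
    (MeasurableEquiv.measurableEmbedding _)]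
  simp only [MeasurableEquiv.finTwoArrow_symm_apply, Fin.cons_zero, Fin.cons_one]
  rw [Measure.volume_eq_prod, lintegral_prod _ (by fun_prop)]
  have hb : 0 < (A * C - B ^ 2) / C := by positivity
  have inner : ∀ x : ℝ, ∫⁻ y : ℝ, ENNReal.ofReal (Real.exp (-(1 / 2) * (A * x ^ 2 +
      2 * B * (x * y) + C * y ^ 2) + (c * x + d * y))) =
      ENNReal.ofReal (√(2 * Real.pi / C) * Real.exp (d ^ 2 / (2 * C))) *
        ENNReal.ofReal (Real.exp (-((A * C - B ^ 2) / C / 2) * x ^ 2 + (c - B * d / C) * x)) := by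
    intro x
    have : ∀ y : ℝ, ENNReal.ofReal (Real.exp (-(1 / 2) * (A * x ^ 2 +
      2 * B * (x * y) + C * y ^ 2) + (c * x + d * y))) =
        ENNReal.ofReal (Real.exp (-(1 / 2) * A * x ^ 2 + c * x)) *
          ENNReal.ofReal (Real.exp (-(C / 2) * y ^ 2 + (d - B * x) * y)) := by
      intro y
      rw [← ENNReal.ofReal_mul (by positivity), ← Real.exp_add]
      congr 2
      ring
    simp_rw [this]
    rw [lintegral_const_mul _ (by fun_prop), lintegral_exp_quadratic hC,
      ← ENNReal.ofReal_mul (by positivity), ← ENNReal.ofReal_mul (by positivity),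
      mul_left_comm, ← Real.exp_add, mul_assoc √(2 * Real.pi / C), ← Real.exp_add]
    congr 3
    field_simp
    ring
  rw [lintegral_congr inner, lintegral_const_mul _ (by fun_prop), lintegral_exp_quadratic hb,
    ← ENNReal.ofReal_mul (by positivity), ENNReal.toReal_ofReal (by positivity),
    mul_mul_mul_comm, ← Real.exp_add, ← Real.sqrt_mul (by positivity)]
  congr 1
  · rw [show 2 * Real.pi / C * (2 * Real.pi / ((A * C - B ^ 2) / C)) =
      (2 * Real.pi) ^ 2 / (A * C - B ^ 2) by field_simp, Real.sqrt_div (by positivity),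
      Real.sqrt_sq (by positivity)]
  · congr 1
    obtain ⟨D, hE⟩ : ∃ D, D = A * C - B ^ 2 := ⟨_, rfl⟩
    rw [← hE] at hD ⊢
    field_simp
    rw [hE]
    ring


/-! ### Closed forms of the BGe marginal likelihoods -/

/-- Entry `(j, k)` of the scatter matrix of the data `x`, corrected for the prior sample size `am`
of the mean. -/
noncomputable def scatter (am : ℝ) {N : ℕ} (x : Fin N → Fin 2 → ℝ) (j k : Fin 2) : ℝ :=
  ∑ i, x i j * x i k - (∑ i, x i j) * (∑ i, x i k) / (am + N)

lemma normalPDF_symMat (m x : Fin 2 → ℝ) (w : ℝ × ℝ × ℝ) :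
    normalPDF m (symMat w) x = √(w.1 * w.2.2 - w.2.1 ^ 2) / (2 * Real.pi) *
      Real.exp (-(1 / 2) * (w.1 * (x 0 - m 0) ^ 2 + 2 * w.2.1 * ((x 0 - m 0) * (x 1 - m 1)) +
        w.2.2 * (x 1 - m 1) ^ 2)) := by
  rw [normalPDF, symMat, Matrix.det_fin_two_of, Real.sqrt_eq_rpow]
  simp only [Matrix.mulVec, dotProduct, Fin.sum_univ_two, Matrix.of_apply, Matrix.cons_val_zero,
    Matrix.cons_val_one, Pi.sub_apply, Nat.cast_ofNat, Matrix.cons_val_fin_one]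
  norm_num
  congr 2
  · rw [sq]
  · ring

lemma smul_symMat (c : ℝ) (w : ℝ × ℝ × ℝ) : c • symMat w = symMat (c • w) := by
  ext i j
  fin_cases i <;> fin_cases j <;> simp [symMat]

lemma inv_symMat (w : ℝ × ℝ × ℝ) :
    (symMat w)⁻¹ 0 0 = w.2.2 / (w.1 * w.2.2 - w.2.1 ^ 2) ∧
      (symMat w)⁻¹ 1 1 = w.1 / (w.1 * w.2.2 - w.2.1 ^ 2) := by
  have hd : (symMat w).det = w.1 * w.2.2 - w.2.1 ^ 2 := by
    rw [symMat, Matrix.det_fin_two_of, sq]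
  rw [Matrix.inv_def, hd, Ring.inverse_eq_inv', symMat, Matrix.adjugate_fin_two_of]
  constructor <;> simp [div_eq_inv_mul]

/-- Only the positivity of the normalizing constant and its independence of `N` matter: its
logarithm disappears after division by `N`. -/
lemma exists_wishartPDF_symMat {aw t : ℝ} (haw : 3 < aw) (ht : 0 < t) :
    ∃ κ > 0, ∀ w : ℝ × ℝ × ℝ, wishartPDF (t • (1 : Matrix (Fin 2) (Fin 2) ℝ)) aw (symMat w) =
      κ * ((w.1 * w.2.2 - w.2.1 ^ 2) ^ ((aw - 3) / 2) *
        Real.exp (-(1 / 2) * (t * w.1 + t * w.2.2))) := by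
  refine ⟨((2 : ℝ) ^ (aw * (2 : ℕ) / 2) * multiGamma 2 (aw / 2) /
    (t • (1 : Matrix (Fin 2) (Fin 2) ℝ)).det ^ (aw / 2))⁻¹, ?_, fun w => ?_⟩
  · have h1 : 0 < multiGamma 2 (aw / 2) := by
      rw [multiGamma, Fin.prod_univ_two]
      have := Real.Gamma_pos_of_pos (s := aw / 2 - ((0 : Fin 2) : ℕ) / 2) (by norm_num; linarith)
      have := Real.Gamma_pos_of_pos (s := aw / 2 - ((1 : Fin 2) : ℕ) / 2) (by norm_num; linarith)
      positivity
    have h2 : 0 < (t • (1 : Matrix (Fin 2) (Fin 2) ℝ)).det := by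
      rw [Matrix.det_smul, Matrix.det_one]
      positivity
    positivity
  · have hd : (symMat w).det = w.1 * w.2.2 - w.2.1 ^ 2 := by
      rw [symMat, Matrix.det_fin_two_of, sq]
    have htr : ((t • (1 : Matrix (Fin 2) (Fin 2) ℝ)) * symMat w).trace = t * w.1 + t * w.2.2 := by
      simp [symMat, Matrix.trace_fin_two]
    rw [wishartPDF, hd, htr, div_eq_mul_inv, show (aw - (2 : ℕ) - 1) / 2 = (aw - 3) / 2 by
      push_cast; ring]
    ring

/-- Conjugacy: given `W`, the integrand is Gaussian in the mean with precision `(am + N) W`.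
Completing the square subtracts the product of sums over `am + N` from the raw second moments, which
is what `scatter` records. -/
lemma integral_normalPDF_edge {am : ℝ} (ham : 0 < am) {N : ℕ} (x : Fin N → Fin 2 → ℝ)
    {w : ℝ × ℝ × ℝ} (hw : 0 < w.1 ∧ 0 < w.1 * w.2.2 - w.2.1 ^ 2) :
    ∫ m : Fin 2 → ℝ, (∏ i, normalPDF m (symMat w) (x i)) * normalPDF 0 (am • symMat w) m =
      (√(w.1 * w.2.2 - w.2.1 ^ 2) / (2 * Real.pi)) ^ N * (am / (am + N)) *
        Real.exp (-(1 / 2) * (w.1 * scatter am x 0 0 + 2 * w.2.1 * scatter am x 0 1 +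
          w.2.2 * scatter am x 1 1)) := by
  obtain ⟨h1, hD⟩ := hw
  obtain ⟨D, hE⟩ : ∃ D, D = w.1 * w.2.2 - w.2.1 ^ 2 := ⟨_, rfl⟩
  have h2 : 0 < w.2.2 := by
    by_contra h
    nlinarith [sq_nonneg w.2.1]
  have hM : 0 < am + N := by positivity
  have hD2 : (am + N) * w.1 * ((am + N) * w.2.2) - ((am + N) * w.2.1) ^ 2 = (am + N) ^ 2 * D := by
    rw [hE]; ring
  have hD3 : am * w.1 * (am * w.2.2) - (am * w.2.1) ^ 2 = am ^ 2 * D := by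
    rw [hE]; ring
  rw [← hE] at hD
  simp_rw [smul_symMat, normalPDF_symMat, Finset.prod_mul_distrib, Finset.prod_const,
    Finset.card_univ, Fintype.card_fin, ← Real.exp_sum, ← Finset.mul_sum]
  simp only [Prod.smul_fst, Prod.smul_snd, smul_eq_mul, Pi.zero_apply, sub_zero, hD3, ← hE]
  set s0 := ∑ i, x i 0 with hs0
  set s1 := ∑ i, x i 1 with hs1
  have key : ∀ m : Fin 2 → ℝ,
      (√D / (2 * Real.pi)) ^ N * Real.exp (-(1 / 2) * ∑ i, (w.1 * (x i 0 - m 0) ^ 2 +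
        2 * w.2.1 * ((x i 0 - m 0) * (x i 1 - m 1)) + w.2.2 * (x i 1 - m 1) ^ 2)) *
      (√(am ^ 2 * D) / (2 * Real.pi) * Real.exp (-(1 / 2) * (am * w.1 * m 0 ^ 2 +
        2 * (am * w.2.1) * (m 0 * m 1) + am * w.2.2 * m 1 ^ 2))) =
      ((√D / (2 * Real.pi)) ^ N * (am * √D / (2 * Real.pi)) *
        Real.exp (-(1 / 2) * (w.1 * ∑ i, x i 0 * x i 0 + 2 * w.2.1 * ∑ i, x i 0 * x i 1 +
          w.2.2 * ∑ i, x i 1 * x i 1))) *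
      Real.exp (-(1 / 2) * ((am + N) * w.1 * m 0 ^ 2 + 2 * ((am + N) * w.2.1) * (m 0 * m 1) +
        (am + N) * w.2.2 * m 1 ^ 2) +
        ((w.1 * s0 + w.2.1 * s1) * m 0 + (w.2.1 * s0 + w.2.2 * s1) * m 1)) := by
    intro m
    have e : ∑ i, (w.1 * (x i 0 - m 0) ^ 2 +
        2 * w.2.1 * ((x i 0 - m 0) * (x i 1 - m 1)) + w.2.2 * (x i 1 - m 1) ^ 2) =
        (w.1 * ∑ i, x i 0 * x i 0 + 2 * w.2.1 * ∑ i, x i 0 * x i 1 +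
          w.2.2 * ∑ i, x i 1 * x i 1) - 2 * (w.1 * m 0 + w.2.1 * m 1) * s0 -
          2 * (w.2.1 * m 0 + w.2.2 * m 1) * s1 +
          N * (w.1 * m 0 ^ 2 + 2 * w.2.1 * (m 0 * m 1) + w.2.2 * m 1 ^ 2) := by
      rw [hs0, hs1]
      simp only [Finset.mul_sum]
      rw [← Finset.sum_add_distrib, ← Finset.sum_add_distrib, ← Finset.sum_sub_distrib,
        ← Finset.sum_sub_distrib]
      have : (N : ℝ) * (w.1 * m 0 ^ 2 + 2 * w.2.1 * (m 0 * m 1) + w.2.2 * m 1 ^ 2) =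
        ∑ i : Fin N, (w.1 * m 0 ^ 2 + 2 * w.2.1 * (m 0 * m 1) + w.2.2 * m 1 ^ 2) := by
        rw [Finset.sum_const, Finset.card_univ, Fintype.card_fin, nsmul_eq_mul]
      rw [this, ← Finset.sum_add_distrib]
      refine Finset.sum_congr rfl fun i _ => ?_
      ring
    have e' : ∀ a b c d : ℝ, a * Real.exp b * (c * Real.exp d) = a * c * Real.exp (b + d) := by
      intro a b c d
      rw [Real.exp_add]; ring
    rw [e, Real.sqrt_mul (by positivity), Real.sqrt_sq ham.le, e', mul_assoc _ (Real.exp _),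
      ← Real.exp_add]
    congr 2
    ring
  simp_rw [key]
  rw [integral_const_mul, integral_exp_quadratic_two (by positivity) (by rw [hD2]; positivity),
    hD2, Real.sqrt_mul (by positivity), Real.sqrt_sq hM.le, scatter, scatter, scatter, ← hs0, ← hs1,
    mul_mul_mul_comm, ← Real.exp_add]
  congr 1
  · have : 0 < √D := Real.sqrt_pos.2 hD
    field_simp
  · congr 1
    field_simp
    rw [hE]
    ring

lemma prod_gaussianPDFReal {h : ℝ} (hh : 0 < h) {N : ℕ} (x : Fin N → ℝ) (m : ℝ) :
    ∏ i, gaussianPDFReal m (1 / h).toNNReal (x i) =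
      √(h / (2 * Real.pi)) ^ N *
        Real.exp (-(1 / 2) * (h * (∑ i, x i * x i) + N * h * m ^ 2) + h * (∑ i, x i) * m) := by
  have hc : (((1 / h).toNNReal : NNReal) : ℝ) = 1 / h := Real.coe_toNNReal _ (by positivity)
  simp only [gaussianPDFReal_def, hc, Finset.prod_mul_distrib, Finset.prod_const,
    Finset.card_univ, Fintype.card_fin, ← Real.exp_sum]
  rw [← Real.sqrt_inv, show (2 * Real.pi * (1 / h))⁻¹ = h / (2 * Real.pi) by field_simp]
  congr 2
  have : (N : ℝ) * h * m ^ 2 = ∑ i : Fin N, h * m ^ 2 := by simp [mul_assoc]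
  rw [this, Finset.mul_sum, Finset.mul_sum, ← Finset.sum_add_distrib, Finset.mul_sum,
    Finset.sum_mul, ← Finset.sum_add_distrib]
  refine Finset.sum_congr rfl fun i _ => ?_
  field_simp
  ring

/-- Here `h` is the marginal precision of variable `j`, the Schur complement of the other diagonal
entry. The data add `N * h` to the `j`-th diagonal entry of the prior precision `am W` and change
nothing else, so the determinant becomes `am (am + N) D`. -/
lemma integral_normalPDF_column {am : ℝ} (ham : 0 < am) {N : ℕ} (x : Fin N → Fin 2 → ℝ)
    {w : ℝ × ℝ × ℝ} (hw : 0 < w.1 ∧ 0 < w.1 * w.2.2 - w.2.1 ^ 2) (j : Fin 2) {h : ℝ}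
    (hh : h = (w.1 * w.2.2 - w.2.1 ^ 2) / ![w.2.2, w.1] j) :
    ∫ m : Fin 2 → ℝ, (∏ i, gaussianPDFReal (m j) ((symMat w)⁻¹ j j).toNNReal (x i j)) *
        normalPDF 0 (am • symMat w) m =
      √(h / (2 * Real.pi)) ^ N * √(am / (am + N)) *
        Real.exp (-(1 / 2) * (h * scatter am x j j)) := by
  have hI := inv_symMat w
  obtain ⟨h1, hD⟩ := hw
  obtain ⟨D, hE⟩ : ∃ D, D = w.1 * w.2.2 - w.2.1 ^ 2 := ⟨_, rfl⟩
  have h2 : 0 < w.2.2 := by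
    by_contra h
    nlinarith [sq_nonneg w.2.1]
  have hM : 0 < am + N := by positivity
  have hD3 : am * w.1 * (am * w.2.2) - (am * w.2.1) ^ 2 = am ^ 2 * D := by
    rw [hE]; ring
  rw [← hE] at hD hI hh
  have hpos : 0 < h := by
    rw [hh]
    fin_cases j
    · exact div_pos hD h2
    · exact div_pos hD h1
  have hinv : (symMat w)⁻¹ j j = 1 / h := by
    rw [hh, one_div_div]
    fin_cases j
    · exact hI.1
    · exact hI.2
  simp_rw [hinv, prod_gaussianPDFReal hpos, smul_symMat, normalPDF_symMat]
  simp only [Prod.smul_fst, Prod.smul_snd, smul_eq_mul, Pi.zero_apply, sub_zero, hD3]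
  rw [Real.sqrt_mul (by positivity), Real.sqrt_sq ham.le]
  set s := ∑ i, x i j with hs
  -- The indicators of the two columns allow one computation for both. Only their idempotence and
  -- `e0 * e1 = 0` are needed, besides `D = h * (w₂₂ e0 + w₁₁ e1)`.
  obtain ⟨e0, he0⟩ : ∃ e0 : ℝ, e0 = if j = 0 then 1 else 0 := ⟨_, rfl⟩
  obtain ⟨e1, he1⟩ : ∃ e1 : ℝ, e1 = if j = 0 then 0 else 1 := ⟨_, rfl⟩
  have key : ∀ m : Fin 2 → ℝ,
      √(h / (2 * Real.pi)) ^ N * Real.exp (-(1 / 2) * (h * (∑ i, x i j * x i j) +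
        N * h * m j ^ 2) + h * s * m j) *
      (am * √D / (2 * Real.pi) * Real.exp (-(1 / 2) * (am * w.1 * m 0 ^ 2 +
        2 * (am * w.2.1) * (m 0 * m 1) + am * w.2.2 * m 1 ^ 2))) =
      (√(h / (2 * Real.pi)) ^ N * (am * √D / (2 * Real.pi)) *
        Real.exp (-(1 / 2) * (h * ∑ i, x i j * x i j))) *
      Real.exp (-(1 / 2) * ((am * w.1 + N * h * e0) * m 0 ^ 2 + 2 * (am * w.2.1) * (m 0 * m 1) +
        (am * w.2.2 + N * h * e1) * m 1 ^ 2) + (h * s * e0 * m 0 + h * s * e1 * m 1)) := by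
    intro m
    have e : ∀ a b c d : ℝ, a * Real.exp b * (c * Real.exp d) = a * c * Real.exp (b + d) := by
      intro a b c d
      rw [Real.exp_add]; ring
    rw [e, mul_assoc _ (Real.exp _), ← Real.exp_add]
    congr 2
    rw [he0, he1]
    fin_cases j <;> simp <;> ring
  simp_rw [key]
  have he0n : 0 ≤ e0 := by rw [he0]; split_ifs <;> norm_num
  have he1n : 0 ≤ e1 := by rw [he1]; split_ifs <;> norm_num
  have hD4 : (am * w.1 + N * h * e0) * (am * w.2.2 + N * h * e1) - (am * w.2.1) ^ 2 =
      am * (am + N) * D := by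
    have : D = h * (w.2.2 * e0 + w.1 * e1) := by
      rw [hh, he0, he1]
      fin_cases j <;> simp <;> field_simp
    have h01 : e0 * e1 = 0 := by
      rw [he0, he1]; split_ifs <;> norm_num
    linear_combination hD3 - am * N * this + N ^ 2 * h ^ 2 * h01
  have hq : (am * w.2.2 + N * h * e1) * (h * s * e0) ^ 2 -
      2 * (am * w.2.1) * (h * s * e0) * (h * s * e1) +
      (am * w.1 + N * h * e0) * (h * s * e1) ^ 2 = am * h * s ^ 2 * D := by
    have h01 : e0 * e1 = 0 := by
      rw [he0, he1]; split_ifs <;> norm_num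
    have h0 : e0 ^ 2 = e0 := by
      rw [he0]; split_ifs <;> norm_num
    have h1 : e1 ^ 2 = e1 := by
      rw [he1]; split_ifs <;> norm_num
    have : D = h * (w.2.2 * e0 + w.1 * e1) := by
      rw [hh, he0, he1]
      fin_cases j <;> simp <;> field_simp
    rw [this]
    linear_combination am * w.2.2 * h ^ 2 * s ^ 2 * h0 + am * w.1 * h ^ 2 * s ^ 2 * h1 +
      (N * h ^ 3 * s ^ 2 * (e0 + e1) - 2 * am * w.2.1 * h ^ 2 * s ^ 2) * h01
  rw [integral_const_mul, integral_exp_quadratic_two (by positivity) (by rw [hD4]; positivity),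
    hD4, hq, scatter, ← hs, mul_mul_mul_comm, ← Real.exp_add]
  congr 1
  · have : 0 < √D := Real.sqrt_pos.2 hD
    have h3 : 0 < √am := Real.sqrt_pos.2 ham
    have h4 : 0 < √(am + N) := Real.sqrt_pos.2 hM
    rw [Real.sqrt_mul (by positivity), Real.sqrt_mul (by positivity), Real.sqrt_div ham.le]
    field_simp
    rw [Real.sq_sqrt ham.le]
  · congr 1
    field_simp
    ring


/-- Integrating out the mean in a normal-Wishart integral. -/
lemma normalWishartIntegral_eq_toReal {am aw t κ c : ℝ}
    (hW : ∀ w : ℝ × ℝ × ℝ, wishartPDF (t • (1 : Matrix (Fin 2) (Fin 2) ℝ)) aw (symMat w) =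
      κ * ((w.1 * w.2.2 - w.2.1 ^ 2) ^ ((aw - 3) / 2) *
        Real.exp (-(1 / 2) * (t * w.1 + t * w.2.2))))
    {f : (Fin 2 → ℝ) → Matrix (Fin 2) (Fin 2) ℝ → ℝ} {g : ℝ × ℝ × ℝ → ℝ} (hg : Measurable g)
    (hg0 : ∀ w, 0 ≤ g w)
    (hf : ∀ w : ℝ × ℝ × ℝ, 0 < w.1 ∧ 0 < w.1 * w.2.2 - w.2.1 ^ 2 →
      ∫ m, f m (symMat w) * normalPDF 0 (am • symMat w) m = c * g w) :
    normalWishartIntegral am aw t f = κ * c *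
      (∫⁻ w in {w : ℝ × ℝ × ℝ | 0 < w.1 ∧ 0 < w.1 * w.2.2 - w.2.1 ^ 2},
        ENNReal.ofReal (g w * ((w.1 * w.2.2 - w.2.1 ^ 2) ^ ((aw - 3) / 2) *
          Real.exp (-(1 / 2) * (t * w.1 + t * w.2.2))))).toReal := by
  rw [normalWishartIntegral]
  simp_rw [symMat_posDef_iff, hW]
  rw [← integral_eq_lintegral_of_nonneg_ae, ← integral_const_mul]
  · refine setIntegral_congr_fun measurableSet_posDef fun w hw => ?_
    simp only [hf w hw]
    ring
  · refine ae_restrict_of_forall_mem measurableSet_posDef fun w hw => ?_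
    have := hg0 w
    have := Real.rpow_nonneg hw.2.le ((aw - 3) / 2)
    simp only [Pi.zero_apply]
    positivity
  · exact (by fun_prop : Measurable _).aestronglyMeasurable

/-- The BGe marginal likelihood of the complete graph. -/
theorem exists_bgeEdge_eq {am aw t : ℝ} (ham : 0 < am) (haw : 3 < aw) (ht : 0 < t) :
    ∃ C > 0, ∀ (N : ℕ) (x : Fin N → Fin 2 → ℝ), 0 < t + scatter am x 1 1 →
      0 < (t + scatter am x 0 0) * (t + scatter am x 1 1) - scatter am x 0 1 ^ 2 →
      bgeEdge am aw t x = C * (am / (am + N)) * (1 / Real.pi) ^ N *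
        (Real.Gamma ((aw + N) / 2) * Real.Gamma ((aw + N) / 2 - 1 / 2)) /
        ((t + scatter am x 0 0) * (t + scatter am x 1 1) - scatter am x 0 1 ^ 2) ^
          ((aw + N) / 2) := by
  obtain ⟨κ, hκ, hW⟩ := exists_wishartPDF_symMat haw ht
  refine ⟨κ * √Real.pi * 2 ^ aw, by positivity, fun N x hR hD => ?_⟩
  set R₀ := t + scatter am x 0 0 with hR0
  set R₁ := t + scatter am x 1 1 with hR1
  set c := scatter am x 0 1 with hc
  obtain ⟨s, hs⟩ : ∃ s, s = (aw + N) / 2 := ⟨_, rfl⟩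
  have hs3 : 3 / 2 < s := by
    rw [hs]
    have : (0 : ℝ) ≤ N := Nat.cast_nonneg N
    linarith
  rw [bgeEdge, normalWishartIntegral_eq_toReal
    (c := (1 / (2 * Real.pi)) ^ N * (am / (am + N))) hW
    (g := fun w => √(w.1 * w.2.2 - w.2.1 ^ 2) ^ N *
      Real.exp (-(1 / 2) * (w.1 * scatter am x 0 0 + 2 * w.2.1 * scatter am x 0 1 +
          w.2.2 * scatter am x 1 1))) (by fun_prop) (fun w => by positivity)
    (fun w hw => by
      rw [integral_normalPDF_edge ham x hw, div_eq_mul_one_div (√_), mul_pow]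
      ring)]
  rw [lintegral_posDef (by fun_prop)]
  have hDR : 0 < R₀ - c ^ 2 / R₁ := by
    rw [show R₀ - c ^ 2 / R₁ = (R₀ * R₁ - c ^ 2) / R₁ by field_simp]
    exact div_pos hD hR
  -- The determinant `x * h` carries the exponent `N / 2` from the likelihood and `(aw - 3) / 2`
  -- from the prior; their sum is `(s - 1 / 2) - 1`.
  have key := lintegral_normalWishart_kernel (u := s - 1 / 2) (v := s - 1 / 2) (r₁ := R₀) (r₂ := R₁)
    (r₃ := R₁) (r₁₂ := c) (by linarith) (by linarith) hR hR hDR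
  have : ∫⁻ x in Set.Ioi (0 : ℝ), ∫⁻ y : ℝ, ∫⁻ h in Set.Ioi (0 : ℝ),
      ENNReal.ofReal (√(x * (h + y ^ 2 / x) - y ^ 2) ^ N *
        Real.exp (-(1 / 2) * (x * (R₀ - t) + 2 * y * c + (h + y ^ 2 / x) * (R₁ - t))) *
        ((x * (h + y ^ 2 / x) - y ^ 2) ^ ((aw - 3) / 2) *
          Real.exp (-(1 / 2) * (t * x + t * (h + y ^ 2 / x))))) =
      ∫⁻ x in Set.Ioi (0 : ℝ), ∫⁻ y : ℝ, ∫⁻ h in Set.Ioi (0 : ℝ),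
      ENNReal.ofReal (h ^ (s - 1 / 2 - 1) * x ^ (s - 1 / 2 - 1) *
        Real.exp (-(1 / 2) * (R₀ * x + 2 * c * y + R₁ * (y ^ 2 / x) + R₁ * h))) := by
    refine setLIntegral_congr_fun measurableSet_Ioi fun x hx => lintegral_congr fun y =>
      setLIntegral_congr_fun measurableSet_Ioi fun h hh => ?_
    have hx : 0 < x := hx
    have hh : 0 < h := hh
    congr 1
    rw [show x * (h + y ^ 2 / x) - y ^ 2 = h * x by field_simp; ring, Real.sqrt_eq_rpow,
      ← Real.rpow_mul_natCast (by positivity), mul_mul_mul_comm, ← Real.exp_add,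
      ← Real.rpow_add (by positivity), ← Real.mul_rpow hh.le hx.le]
    congr 2
    · rw [hs]; ring
    · ring
  simp only [hR0, hR1, add_sub_cancel_left] at this
  rw [this, ← hR0, ← hR1, key, ENNReal.toReal_ofReal, ← hs]
  · rw [show s - 1 / 2 + 1 / 2 = s by ring, show R₀ - c ^ 2 / R₁ = (R₀ * R₁ - c ^ 2) / R₁ by
      field_simp, div_div_eq_mul_div]
    -- The factor `2 ^ N` cancels against the `(2π)⁻ᴺ` of the likelihood, and `2 ^ aw` goes into the
    -- constant.
    have h2s : (2 : ℝ) ^ (s * 2) = 2 ^ aw * 2 ^ N := by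
      rw [← Real.rpow_natCast, ← Real.rpow_add two_pos, hs]
      congr 1
      ring
    rw [Real.div_rpow (by positivity) hD.le, Real.div_rpow (by positivity) hR.le,
      Real.mul_rpow (by positivity) hR.le, Real.sqrt_div (by positivity),
      Real.sqrt_mul (by positivity), Real.rpow_sub hR, Real.rpow_sub two_pos,
      ← Real.sqrt_eq_rpow, ← Real.sqrt_eq_rpow, one_div_pow, one_div_pow, mul_pow]
    have hr := Real.sqrt_pos.2 hR
    have h22 : (2 : ℝ) ^ s * 2 ^ s = 2 ^ aw * 2 ^ N := by
      rw [← h2s, Real.rpow_mul two_pos.le]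
      norm_num [sq]
    have hRs : 0 < R₁ ^ s := by positivity
    have hDs : 0 < (R₀ * R₁ - c ^ 2) ^ s := by positivity
    generalize Real.Gamma (s - 1 / 2) = G
    field_simp
    linear_combination G * h22
  · have := Real.Gamma_pos_of_pos (s := s - 1 / 2) (by linarith)
    have := Real.Gamma_pos_of_pos (s := s - 1 / 2 + 1 / 2) (by linarith)
    positivity

/-- The marginal precision of the second variable is the coordinate `h` itself. The integrals over
`x` and `y` therefore do not involve the data and contribute constants. -/
lemma lintegral_column_kernel {aw t c : ℝ} (haw : 3 < aw) (ht : 0 < t) (hR : 0 < t + c) (N : ℕ) :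
    ∫⁻ w in {w : ℝ × ℝ × ℝ | 0 < w.1 ∧ 0 < w.1 * w.2.2 - w.2.1 ^ 2},
      ENNReal.ofReal (√((w.1 * w.2.2 - w.2.1 ^ 2) / w.1) ^ N *
        Real.exp (-(1 / 2) * ((w.1 * w.2.2 - w.2.1 ^ 2) / w.1 * c)) *
        ((w.1 * w.2.2 - w.2.1 ^ 2) ^ ((aw - 3) / 2) *
          Real.exp (-(1 / 2) * (t * w.1 + t * w.2.2)))) =
      ENNReal.ofReal (Real.Gamma ((aw + N) / 2 - 1 / 2) *
        (2 / (t + c)) ^ ((aw + N) / 2 - 1 / 2) * √(2 * Real.pi / t) *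
        (Real.Gamma (aw / 2) * (2 / t) ^ (aw / 2))) := by
  rw [lintegral_posDef (by fun_prop)]
  have hN : (0 : ℝ) ≤ N := Nat.cast_nonneg N
  have key := lintegral_normalWishart_kernel (u := (aw + N) / 2 - 1 / 2) (v := aw / 2 - 1 / 2)
    (r₁ := t) (r₂ := t) (r₃ := t + c) (r₁₂ := 0) (by linarith) (by linarith) ht hR
    (by simpa using ht)
  rw [show aw / 2 - 1 / 2 + 1 / 2 = aw / 2 by ring, zero_pow two_ne_zero, zero_div, sub_zero] at key
  rw [← key]
  refine setLIntegral_congr_fun measurableSet_Ioi fun x hx => lintegral_congr fun y =>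
    setLIntegral_congr_fun measurableSet_Ioi fun h hh => ?_
  have hx : 0 < x := hx
  have hh : 0 < h := hh
  simp only
  congr 1
  rw [show x * (h + y ^ 2 / x) - y ^ 2 = h * x by field_simp; ring, mul_div_cancel_right₀ h hx.ne',
    Real.sqrt_eq_rpow, ← Real.rpow_mul_natCast hh.le, mul_mul_mul_comm, ← Real.exp_add,
    Real.mul_rpow hh.le hx.le, ← mul_assoc, ← Real.rpow_add hh]
  congr 1
  · congr 2 <;> ring
  · congr 1
    ring

/-- The BGe marginal likelihood of the data of a single variable. -/
theorem exists_bgeColumn_eq {am aw t : ℝ} (ham : 0 < am) (haw : 3 < aw) (ht : 0 < t) :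
    ∃ C > 0, ∀ (j : Fin 2) (N : ℕ) (x : Fin N → Fin 2 → ℝ), 0 < t + scatter am x j j →
      bgeColumn am aw t j x = C * √(am / (am + N)) * (1 / √Real.pi) ^ N *
        Real.Gamma ((aw + N) / 2 - 1 / 2) /
        (t + scatter am x j j) ^ ((aw + N) / 2 - 1 / 2) := by
  obtain ⟨κ, hκ, hW⟩ := exists_wishartPDF_symMat haw ht
  have hG := Real.Gamma_pos_of_pos (s := aw / 2) (by linarith)
  refine ⟨κ * √(2 * Real.pi / t) * (Real.Gamma (aw / 2) * (2 / t) ^ (aw / 2)) *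
    2 ^ (aw / 2 - 1 / 2), by positivity, fun j N x hR => ?_⟩
  have hN : (0 : ℝ) ≤ N := Nat.cast_nonneg N
  have hj : ∫⁻ w in {w : ℝ × ℝ × ℝ | 0 < w.1 ∧ 0 < w.1 * w.2.2 - w.2.1 ^ 2},
      ENNReal.ofReal (√((w.1 * w.2.2 - w.2.1 ^ 2) / ![w.2.2, w.1] j) ^ N *
        Real.exp (-(1 / 2) * ((w.1 * w.2.2 - w.2.1 ^ 2) / ![w.2.2, w.1] j * scatter am x j j)) *
        ((w.1 * w.2.2 - w.2.1 ^ 2) ^ ((aw - 3) / 2) *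
          Real.exp (-(1 / 2) * (t * w.1 + t * w.2.2)))) =
      ENNReal.ofReal (Real.Gamma ((aw + N) / 2 - 1 / 2) *
        (2 / (t + scatter am x j j)) ^ ((aw + N) / 2 - 1 / 2) * √(2 * Real.pi / t) *
        (Real.Gamma (aw / 2) * (2 / t) ^ (aw / 2))) := by
    rw [← lintegral_column_kernel haw ht hR]
    fin_cases j
    · rw [lintegral_posDef_swap]
      simp only [Fin.zero_eta, Matrix.cons_val_zero, mul_comm, add_comm]
    · rfl
  have hm : Measurable fun w : ℝ × ℝ × ℝ =>
      √((w.1 * w.2.2 - w.2.1 ^ 2) / ![w.2.2, w.1] j) ^ N *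
        Real.exp (-(1 / 2) * ((w.1 * w.2.2 - w.2.1 ^ 2) / ![w.2.2, w.1] j *
          scatter am x j j)) := by
    have : Measurable fun w : ℝ × ℝ × ℝ => ![w.2.2, w.1] j := by
      fin_cases j
      · exact measurable_snd.snd
      · exact measurable_fst
    fun_prop
  rw [bgeColumn, normalWishartIntegral_eq_toReal
    (c := (1 / √(2 * Real.pi)) ^ N * √(am / (am + N))) hW hm
    (fun w => by positivity)
    (fun w hw => by
      rw [integral_normalPDF_column ham x hw j rfl, Real.sqrt_div' _ (by positivity),
        div_eq_mul_one_div (√_), mul_pow]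
      ring), hj, ENNReal.toReal_ofReal]
  · rw [Real.div_rpow two_pos.le hR.le,
      show (2 : ℝ) ^ ((aw + N) / 2 - 1 / 2) = 2 ^ (aw / 2 - 1 / 2) * √2 ^ N by
        rw [Real.sqrt_eq_rpow, ← Real.rpow_mul_natCast two_pos.le, ← Real.rpow_add two_pos]
        congr 1
        ring]
    rw [Real.sqrt_mul two_pos.le, one_div_pow, one_div_pow, mul_pow]
    field_simp
  · have := Real.Gamma_pos_of_pos (s := (aw + N) / 2 - 1 / 2) (by linarith)
    positivity

/-- The ratio of the BGe marginal likelihoods of the two graphs. -/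
theorem exists_bge_ratio {am aw t : ℝ} (ham : 0 < am) (haw : 3 < aw) (ht : 0 < t) :
    ∃ C > 0, ∀ (N : ℕ) (x : Fin N → Fin 2 → ℝ), 0 < t + scatter am x 0 0 →
      0 < t + scatter am x 1 1 →
      0 < (t + scatter am x 0 0) * (t + scatter am x 1 1) - scatter am x 0 1 ^ 2 →
      0 < bgeEdge am aw t x ∧ 0 < bgeEmpty am aw t x ∧
      bgeEdge am aw t x / bgeEmpty am aw t x =
        C * (Real.Gamma ((aw + N) / 2) / Real.Gamma ((aw + N) / 2 - 1 / 2)) *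
        (((t + scatter am x 0 0) * (t + scatter am x 1 1)) ^ ((aw + N) / 2 - 1 / 2) /
        ((t + scatter am x 0 0) * (t + scatter am x 1 1) - scatter am x 0 1 ^ 2) ^
          ((aw + N) / 2)) := by
  obtain ⟨C₁, hC₁, h₁⟩ := exists_bgeEdge_eq ham haw ht
  obtain ⟨C₀, hC₀, h₀⟩ := exists_bgeColumn_eq ham haw ht
  refine ⟨C₁ / C₀ ^ 2, by positivity, fun N x hR0 hR1 hD => ?_⟩
  have hN : (0 : ℝ) ≤ N := Nat.cast_nonneg N
  have hG := Real.Gamma_pos_of_pos (s := (aw + N) / 2) (by linarith)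
  have hG' := Real.Gamma_pos_of_pos (s := (aw + N) / 2 - 1 / 2) (by linarith)
  rw [h₁ N x hR1 hD, bgeEmpty, h₀ 0 N x hR0, h₀ 1 N x hR1]
  refine ⟨by positivity, by positivity, ?_⟩
  rw [Real.mul_rpow hR0.le hR1.le, one_div_pow, one_div_pow]
  have hM : 0 < am / (am + N) := by positivity
  have hD' := Real.rpow_pos_of_pos hD ((aw + N) / 2)
  -- Each column carries the square root of the corresponding factors of the complete graph, so the
  -- factors from the mean and the powers of `π` cancel exactly.
  have e1 : √(am / (am + N)) * √(am / (am + N)) = am / (am + N) := Real.mul_self_sqrt hM.le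
  have e2 : √Real.pi ^ N * √Real.pi ^ N = Real.pi ^ N := by
    rw [← mul_pow, Real.mul_self_sqrt Real.pi_pos.le]
  generalize √(am / (am + N)) = Q at e1 ⊢
  have hQ : 0 < Q * Q := e1 ▸ hM
  have hQ0 : Q ≠ 0 := fun h => by simp [h] at hQ
  rw [← e1, ← e2]
  field_simp


/-! ### Closed forms of the BDe marginal likelihoods -/

/-- The number of observations with value `c`. -/
def count {α : Type*} [DecidableEq α] {N : ℕ} (x : Fin N → α) (c : α) : ℕ :=
  (Finset.univ.filter fun i => x i = c).card

lemma prod_comp_eq_prod_pow_count {α : Type*} [Fintype α] [DecidableEq α] {N : ℕ}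
    (x : Fin N → α) (f : α → ℝ) : ∏ i, f (x i) = ∏ c, f c ^ count x c := by
  rw [← Finset.prod_fiberwise' Finset.univ x f]
  simp [count]

lemma sum_comp_eq_sum_count_mul {α : Type*} [Fintype α] [DecidableEq α] {N : ℕ}
    (x : Fin N → α) (f : α → ℝ) : ∑ i, f (x i) = ∑ c, count x c * f c := by
  rw [← Finset.sum_fiberwise' Finset.univ x f]
  simp [count]

lemma sum_count {α : Type*} [Fintype α] [DecidableEq α] {N : ℕ} (x : Fin N → α) :
    ∑ c, (count x c : ℝ) = N := by
  simpa using (sum_comp_eq_sum_count_mul x fun _ => 1).symm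

lemma integrable_betaPDFReal {u v : ℝ} (hu : 0 < u) (hv : 0 < v) :
    Integrable (betaPDFReal u v) := by
  refine ⟨(measurable_betaPDFReal u v).aestronglyMeasurable, ?_⟩
  rw [hasFiniteIntegral_iff_ofReal (ae_of_all _ fun x => ?_)]
  · have := lintegral_betaPDF_eq_one hu hv
    simp only [betaPDF] at this
    rw [this]
    exact ENNReal.one_lt_top
  · by_cases h : 0 < x ∧ x < 1
    · exact (betaPDFReal_pos h.1 h.2 hu hv).le
    · simp [betaPDFReal, h]

lemma betaPDFReal_nonneg {u v : ℝ} (hu : 0 < u) (hv : 0 < v) (x : ℝ) : 0 ≤ betaPDFReal u v x := by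
  by_cases h : 0 < x ∧ x < 1
  · exact (betaPDFReal_pos h.1 h.2 hu hv).le
  · simp [betaPDFReal, h]

lemma integral_betaPDFReal {u v : ℝ} (hu : 0 < u) (hv : 0 < v) :
    ∫ x, betaPDFReal u v x = 1 := by
  rw [integral_eq_lintegral_of_nonneg_ae (ae_of_all _ (betaPDFReal_nonneg hu hv))
    (measurable_betaPDFReal u v).aestronglyMeasurable]
  have := lintegral_betaPDF_eq_one hu hv
  simp only [betaPDF] at this
  simp [this]

/-- The scaled Beta integral. -/
lemma lintegral_beta {u v r : ℝ} (hu : 0 < u) (hv : 0 < v) (hr : 0 < r) :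
    ∫⁻ y in Set.Ioo 0 r, ENNReal.ofReal (y ^ (u - 1) * (r - y) ^ (v - 1)) =
      ENNReal.ofReal (r ^ (u + v - 1) * beta u v) := by
  have hb := beta_pos hu hv
  have key : ∀ y, (Set.Ioo 0 r).indicator
      (fun y => ENNReal.ofReal (y ^ (u - 1) * (r - y) ^ (v - 1))) y =
      ENNReal.ofReal (r ^ (u + v - 2) * beta u v) *
        ENNReal.ofReal (betaPDFReal u v (r⁻¹ * y)) := by
    intro y
    by_cases hy : y ∈ Set.Ioo 0 r
    · have hy0 : 0 < y := hy.1
      have hyr : 0 < r - y := sub_pos.2 hy.2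
      have h1 : 0 < r⁻¹ * y ∧ r⁻¹ * y < 1 :=
        ⟨by positivity, by rw [inv_mul_lt_iff₀ hr, mul_one]; exact hy.2⟩
      rw [Set.indicator_of_mem hy, betaPDFReal, if_pos h1, ← ENNReal.ofReal_mul (by positivity),
        show 1 - r⁻¹ * y = r⁻¹ * (r - y) by field_simp,
        Real.mul_rpow (by positivity) hy0.le, Real.mul_rpow (by positivity) hyr.le,
        show u + v - 2 = (u - 1) + (v - 1) by ring, Real.rpow_add hr, Real.inv_rpow hr.le,
        Real.inv_rpow hr.le]
      congr 1
      have := Real.rpow_pos_of_pos hr (u - 1)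
      have := Real.rpow_pos_of_pos hr (v - 1)
      field_simp
    · have h1 : ¬ (0 < r⁻¹ * y ∧ r⁻¹ * y < 1) := by
        rintro ⟨h1, h2⟩
        rw [inv_mul_lt_iff₀ hr, mul_one] at h2
        exact hy ⟨(mul_pos_iff_of_pos_left (by positivity)).1 h1, h2⟩
      rw [Set.indicator_of_notMem hy, betaPDFReal, if_neg h1]
      simp
  have hint : Integrable fun y => betaPDFReal u v (r⁻¹ * y) :=
    (integrable_betaPDFReal hu hv).comp_mul_left' (by positivity)
  rw [← lintegral_indicator measurableSet_Ioo, lintegral_congr key,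
    lintegral_const_mul' _ _ ENNReal.ofReal_ne_top,
    ← ofReal_integral_eq_lintegral_ofReal hint
      (ae_of_all _ fun y => betaPDFReal_nonneg hu hv _),
    Measure.integral_comp_mul_left, integral_betaPDFReal hu hv, ← ENNReal.ofReal_mul
      (by positivity), inv_inv, abs_of_pos hr, smul_eq_mul, mul_one,
    show u + v - 1 = (u + v - 2) + 1 by ring, Real.rpow_add_one hr.ne']
  congr 1
  ring

lemma measurableSet_cellProb_pos :
    MeasurableSet {θ : ℝ × ℝ × ℝ | ∀ c, 0 < cellProb θ c} := by
  have : {θ : ℝ × ℝ × ℝ | ∀ c, 0 < cellProb θ c} =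
      {θ : ℝ × ℝ × ℝ | 0 < θ.1 ∧ 0 < θ.2.1 ∧ 0 < θ.2.2 ∧ 0 < 1 - θ.1 - θ.2.1 - θ.2.2} := by
    ext θ
    simp [cellProb]
    tauto
  rw [this]
  measurability

/-- The Dirichlet integral with four parameters. -/
lemma lintegral_dirichlet {a b c d : ℝ} (ha : 0 < a) (hb : 0 < b) (hc : 0 < c) (hd : 0 < d) :
    ∫⁻ θ in {θ : ℝ × ℝ × ℝ | ∀ c, 0 < cellProb θ c},
      ENNReal.ofReal (θ.1 ^ (a - 1) * θ.2.1 ^ (b - 1) * θ.2.2 ^ (c - 1) *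
        (1 - θ.1 - θ.2.1 - θ.2.2) ^ (d - 1)) =
      ENNReal.ofReal (Real.Gamma a * Real.Gamma b * Real.Gamma c * Real.Gamma d /
        Real.Gamma (a + b + c + d)) := by
  have hm : Measurable (Set.indicator {θ : ℝ × ℝ × ℝ | ∀ c, 0 < cellProb θ c} fun θ =>
      ENNReal.ofReal (θ.1 ^ (a - 1) * θ.2.1 ^ (b - 1) * θ.2.2 ^ (c - 1) *
        (1 - θ.1 - θ.2.1 - θ.2.2) ^ (d - 1))) :=
    Measurable.indicator (by fun_prop) measurableSet_cellProb_pos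
  -- The simplex as nested intervals, each of the length left over by the earlier coordinates: every
  -- inner integral is then a scaled Beta integral.
  have hmem : ∀ x y z : ℝ, (x, y, z) ∈ {θ : ℝ × ℝ × ℝ | ∀ c, 0 < cellProb θ c} ↔
      x ∈ Set.Ioo 0 1 ∧ y ∈ Set.Ioo 0 (1 - x) ∧ z ∈ Set.Ioo 0 (1 - x - y) := by
    intro x y z
    simp only [Set.mem_ofPred_eq, Prod.forall, Bool.forall_bool, cellProb, Set.mem_Ioo]
    constructor
    · rintro ⟨⟨h1, h2⟩, h3, h4⟩
      refine ⟨⟨?_, ?_⟩, ⟨?_, ?_⟩, ?_, ?_⟩ <;> linarith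
    · rintro ⟨⟨h1, h2⟩, ⟨h3, h4⟩, h5, h6⟩
      refine ⟨⟨?_, ?_⟩, ?_, ?_⟩ <;> linarith
  have hB1 := beta_pos hc hd
  have hB2 := beta_pos hb (add_pos hc hd)
  have hB3 := beta_pos ha (add_pos hb (add_pos hc hd))
  have inner : ∀ x y : ℝ, ∫⁻ z : ℝ, Set.indicator {θ : ℝ × ℝ × ℝ | ∀ c, 0 < cellProb θ c} (fun θ =>
      ENNReal.ofReal (θ.1 ^ (a - 1) * θ.2.1 ^ (b - 1) * θ.2.2 ^ (c - 1) *
        (1 - θ.1 - θ.2.1 - θ.2.2) ^ (d - 1))) (x, y, z) =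
      (Set.Ioo 0 1).indicator (fun x => (Set.Ioo 0 (1 - x)).indicator (fun y =>
        ENNReal.ofReal (x ^ (a - 1) * beta c d) *
        ENNReal.ofReal (y ^ (b - 1) * ((1 - x) - y) ^ (c + d - 1))) y) x := by
    intro x y
    by_cases hx : x ∈ Set.Ioo (0 : ℝ) 1
    · rw [Set.indicator_of_mem hx]
      by_cases hy : y ∈ Set.Ioo 0 (1 - x)
      · rw [Set.indicator_of_mem hy]
        have hx0 : 0 < x := hx.1
        have hy0 : 0 < y := hy.1
        have hr : 0 < 1 - x - y := by linarith [hy.2]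
        have h : ∀ z, Set.indicator {θ : ℝ × ℝ × ℝ | ∀ c, 0 < cellProb θ c} (fun θ =>
            ENNReal.ofReal (θ.1 ^ (a - 1) * θ.2.1 ^ (b - 1) * θ.2.2 ^ (c - 1) *
            (1 - θ.1 - θ.2.1 - θ.2.2) ^ (d - 1))) (x, y, z) =
            ENNReal.ofReal (x ^ (a - 1) * y ^ (b - 1)) * (Set.Ioo 0 (1 - x - y)).indicator (fun z =>
              ENNReal.ofReal (z ^ (c - 1) * (1 - x - y - z) ^ (d - 1))) z := by
          intro z
          by_cases hz : z ∈ Set.Ioo 0 (1 - x - y)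
          · rw [Set.indicator_of_mem hz, Set.indicator_of_mem ((hmem x y z).2 ⟨hx, hy, hz⟩),
              ← ENNReal.ofReal_mul (by positivity)]
            simp only [mul_assoc]
          · rw [Set.indicator_of_notMem hz,
              Set.indicator_of_notMem (fun h => hz ((hmem x y z).1 h).2.2), mul_zero]
        rw [lintegral_congr h, lintegral_const_mul' _ _ ENNReal.ofReal_ne_top,
          lintegral_indicator measurableSet_Ioo, lintegral_beta hc hd hr,
          ← ENNReal.ofReal_mul (by positivity), ← ENNReal.ofReal_mul (by positivity)]
        congr 1
        ring
      · rw [Set.indicator_of_notMem hy]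
        refine (lintegral_congr fun z => ?_).trans lintegral_zero
        exact Set.indicator_of_notMem (fun h => hy ((hmem x y z).1 h).2.1) _
    · rw [Set.indicator_of_notMem hx]
      refine (lintegral_congr fun z => ?_).trans lintegral_zero
      exact Set.indicator_of_notMem (fun h => hx ((hmem x y z).1 h).1) _
  rw [← lintegral_indicator measurableSet_cellProb_pos, Measure.volume_eq_prod,
    lintegral_prod _ hm.aemeasurable]
  have middle : ∀ x : ℝ, ∫⁻ w : ℝ × ℝ, Set.indicator {θ : ℝ × ℝ × ℝ | ∀ c, 0 < cellProb θ c}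
      (fun θ => ENNReal.ofReal (θ.1 ^ (a - 1) * θ.2.1 ^ (b - 1) * θ.2.2 ^ (c - 1) *
        (1 - θ.1 - θ.2.1 - θ.2.2) ^ (d - 1))) (x, w) =
      (Set.Ioo 0 1).indicator (fun x => ENNReal.ofReal (beta c d * beta b (c + d)) *
        ENNReal.ofReal (x ^ (a - 1) * (1 - x) ^ (b + (c + d) - 1))) x := by
    intro x
    rw [Measure.volume_eq_prod, lintegral_prod (fun w : ℝ × ℝ => Set.indicator
      {θ : ℝ × ℝ × ℝ | ∀ c, 0 < cellProb θ c} (fun θ => ENNReal.ofReal (θ.1 ^ (a - 1) *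
        θ.2.1 ^ (b - 1) * θ.2.2 ^ (c - 1) * (1 - θ.1 - θ.2.1 - θ.2.2) ^ (d - 1))) (x, w))
      (hm.comp measurable_prodMk_left).aemeasurable]
    simp_rw [inner]
    by_cases hx : x ∈ Set.Ioo (0 : ℝ) 1
    · simp only [Set.indicator_of_mem hx]
      have hx0 : 0 < x := hx.1
      have hr : 0 < 1 - x := by linarith [hx.2]
      rw [lintegral_indicator measurableSet_Ioo, lintegral_const_mul' _ _ ENNReal.ofReal_ne_top,
        lintegral_beta hb (add_pos hc hd) hr, ← ENNReal.ofReal_mul (by positivity),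
        ← ENNReal.ofReal_mul (by positivity)]
      congr 1
      ring
    · simp only [Set.indicator_of_notMem hx, lintegral_zero]
  rw [lintegral_congr middle, lintegral_indicator measurableSet_Ioo,
    lintegral_const_mul' _ _ ENNReal.ofReal_ne_top,
    lintegral_beta ha (add_pos hb (add_pos hc hd)) one_pos, ← ENNReal.ofReal_mul (by positivity)]
  congr 1
  have h1 := Real.Gamma_pos_of_pos (add_pos hc hd)
  have h2 := Real.Gamma_pos_of_pos (add_pos hb (add_pos hc hd))
  rw [Real.one_rpow, one_mul, beta, beta, beta, show a + b + c + d = a + (b + (c + d)) by ring]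
  field_simp

/-- Conjugacy: the likelihood adds the cell counts to the Dirichlet parameters. -/
theorem bdeEdge_eq {a : Fin 4 → ℝ} (ha : ∀ k, 0 < a k) {N : ℕ} (x : Fin N → Bool × Bool) :
    bdeEdge a x = Real.Gamma (a 0 + a 1 + a 2 + a 3) /
        (Real.Gamma (a 0) * Real.Gamma (a 1) * Real.Gamma (a 2) * Real.Gamma (a 3)) *
      (Real.Gamma (a 0 + count x (true, true)) * Real.Gamma (a 1 + count x (true, false)) *
        Real.Gamma (a 2 + count x (false, true)) * Real.Gamma (a 3 + count x (false, false)) /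
        Real.Gamma (a 0 + a 1 + a 2 + a 3 + N)) := by
  have hN := sum_count x
  rw [Fintype.sum_prod_type, Fintype.sum_bool, Fintype.sum_bool, Fintype.sum_bool] at hN
  have hpos : ∀ k, ∀ n : ℕ, 0 < a k + n := fun k n => by
    have := ha k
    positivity
  have key := lintegral_dirichlet (hpos 0 (count x (true, true))) (hpos 1 (count x (true, false)))
    (hpos 2 (count x (false, true))) (hpos 3 (count x (false, false)))
  rw [bdeEdge]
  have e : ∀ θ ∈ {θ : ℝ × ℝ × ℝ | ∀ c, 0 < cellProb θ c},
      (∏ i, cellProb θ (x i)) * dirichletPDF a θ =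
      Real.Gamma (a 0 + a 1 + a 2 + a 3) /
        (Real.Gamma (a 0) * Real.Gamma (a 1) * Real.Gamma (a 2) * Real.Gamma (a 3)) *
      (θ.1 ^ (a 0 + count x (true, true) - 1) * θ.2.1 ^ (a 1 + count x (true, false) - 1) *
        θ.2.2 ^ (a 2 + count x (false, true) - 1) *
        (1 - θ.1 - θ.2.1 - θ.2.2) ^ (a 3 + count x (false, false) - 1)) := by
    intro θ hθ
    have h1 : 0 < θ.1 := hθ (true, true)
    have h2 : 0 < θ.2.1 := hθ (true, false)
    have h3 : 0 < θ.2.2 := hθ (false, true)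
    have h4 : 0 < 1 - θ.1 - θ.2.1 - θ.2.2 := hθ (false, false)
    rw [prod_comp_eq_prod_pow_count, Fintype.prod_prod_type, Fintype.prod_bool, Fintype.prod_bool,
      Fintype.prod_bool, dirichletPDF, Fin.prod_univ_four, Fin.sum_univ_four]
    simp only [cellProb]
    simp only [← Real.rpow_natCast, add_sub_right_comm, Real.rpow_add h1, Real.rpow_add h2,
      Real.rpow_add h3, Real.rpow_add h4]
    rw [one_div_div]
    ring
  rw [setIntegral_congr_fun measurableSet_cellProb_pos e, integral_const_mul,
    integral_eq_lintegral_of_nonneg_ae, key, ENNReal.toReal_ofReal]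
  · congr 3
    linear_combination hN
  · have := fun k n => (Real.Gamma_pos_of_pos (hpos k n))
    have h0 := this 0 (count x (true, true))
    have h1 := this 1 (count x (true, false))
    have h2 := this 2 (count x (false, true))
    have h3 := this 3 (count x (false, false))
    have h4 := Real.Gamma_pos_of_pos (add_pos (add_pos (add_pos (hpos 0 (count x (true, true)))
      (hpos 1 (count x (true, false)))) (hpos 2 (count x (false, true))))
      (hpos 3 (count x (false, false))))
    positivity
  · refine ae_restrict_of_forall_mem measurableSet_cellProb_pos fun θ hθ => ?_
    have h1 : 0 < θ.1 := hθ (true, true)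
    have h2 : 0 < θ.2.1 := hθ (true, false)
    have h3 : 0 < θ.2.2 := hθ (false, true)
    have h4 : 0 < 1 - θ.1 - θ.2.1 - θ.2.2 := hθ (false, false)
    simp only [Pi.zero_apply]
    positivity
  · exact (by fun_prop : Measurable _).aestronglyMeasurable

lemma integral_pow_mul_betaPDFReal {u v : ℝ} (hu : 0 < u) (hv : 0 < v) (k l : ℕ) :
    ∫ s, s ^ k * (1 - s) ^ l * betaPDFReal u v s = beta (u + k) (v + l) / beta u v := by
  have hb := beta_pos hu hv
  have hu' : 0 < u + k := by positivity
  have hv' : 0 < v + l := by positivity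
  have hb' := beta_pos hu' hv'
  have e : ∀ s, s ^ k * (1 - s) ^ l * betaPDFReal u v s =
      beta (u + k) (v + l) / beta u v * betaPDFReal (u + k) (v + l) s := by
    intro s
    by_cases hs : 0 < s ∧ s < 1
    · have h1 : 0 < 1 - s := by linarith [hs.2]
      rw [betaPDFReal, betaPDFReal, if_pos hs, if_pos hs]
      simp only [← Real.rpow_natCast, add_sub_right_comm, Real.rpow_add hs.1, Real.rpow_add h1]
      field_simp
    · rw [betaPDFReal, betaPDFReal, if_neg hs, if_neg hs, mul_zero, mul_zero]
  simp_rw [e]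
  rw [integral_const_mul, integral_betaPDFReal hu' hv', mul_one]

/-- The integrand is a function of `θ₁` times a function of `θ₂`, so the double integral is a
product of two Beta moments, with the marginal counts as exponents. -/
theorem bdeEmpty_eq {a : Fin 4 → ℝ} (ha : ∀ k, 0 < a k) {b₁ b₂ : ℝ} (hb₁ : 0 < b₁) (hb₂ : 0 < b₂)
    {N : ℕ} (x : Fin N → Bool × Bool) :
    bdeEmpty a b₁ b₂ x =
      beta (a 0 + a 1 + (count x (true, true) + count x (true, false) : ℕ))
        (a 2 + a 3 + (count x (false, true) + count x (false, false) : ℕ)) /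
          beta (a 0 + a 1) (a 2 + a 3) *
      (beta (b₁ + (count x (true, true) + count x (false, true) : ℕ))
        (b₂ + (count x (true, false) + count x (false, false) : ℕ)) / beta b₁ b₂) := by
  rw [bdeEmpty, ← integral_pow_mul_betaPDFReal (add_pos (ha 0) (ha 1)) (add_pos (ha 2) (ha 3)),
    ← integral_pow_mul_betaPDFReal hb₁ hb₂, ← integral_mul_const]
  congr 1
  ext θ₁
  rw [← integral_const_mul]
  congr 1
  ext θ₂
  rw [prod_comp_eq_prod_pow_count x fun c => bernProb θ₁ c.1 * bernProb θ₂ c.2,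
    Fintype.prod_prod_type, Fintype.prod_bool, Fintype.prod_bool, Fintype.prod_bool]
  simp only [bernProb, if_true, Bool.false_eq_true, if_false, mul_pow, pow_add]
  ring

/-! ### Asymptotics of the logarithm of the Gamma function -/

/-- A weak form of Stirling's formula, by induction from the functional equation: passing from `n`
to `n + 1` changes the error by `O(1 / (n + 1))`, and these changes sum to a logarithm. The case `n
= 0` is included, with `0 * log 0 = 0`, since cells may be empty. -/
lemma abs_log_Gamma_sub_le {c : ℝ} (hc : 0 < c) :
    ∃ K ≥ 0, ∀ n : ℕ, |Real.log (Real.Gamma (c + n)) - (n * Real.log n - n)| ≤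
      K * (1 + Real.log (n + 1)) := by
  -- Chosen so that `δ * (n + 1) ≤ c + n` for every `n`.
  set δ := min c 1 with hδ
  have hδ0 : 0 < δ := lt_min hc one_pos
  set L := |c - 1| / δ + |c - 1| + 1 with hL
  have hL0 : 0 ≤ L := by positivity
  have step : ∀ n : ℕ, |Real.log (Real.Gamma (c + n)) - (n * Real.log n - n)| ≤
      |Real.log (Real.Gamma c)| + 2 * L * Real.log (n + 1) := by
    intro n
    induction n with
    | zero => simp
    | succ n ih =>
      have hn : (0 : ℝ) ≤ n := Nat.cast_nonneg n
      have hcn : 0 < c + n := by positivity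
      have hn1 : (0 : ℝ) < n + 1 := by positivity
      have hG : Real.log (Real.Gamma (c + (n + 1 : ℕ))) =
          Real.log (c + n) + Real.log (Real.Gamma (c + n)) := by
        rw [Nat.cast_add, Nat.cast_one, ← add_assoc, Real.Gamma_add_one hcn.ne',
          Real.log_mul hcn.ne' (Real.Gamma_pos_of_pos hcn).ne']
      have h1 : |Real.log ((c + n) / (n + 1))| ≤ (|c - 1| / δ + |c - 1|) / (n + 1) := by
        have hcn' : δ * (n + 1) ≤ c + n := by
          have h1 : δ ≤ c := min_le_left _ _
          have h2 : δ ≤ 1 := min_le_right _ _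
          nlinarith
        rw [abs_le]
        constructor
        · have := Real.one_sub_inv_le_log_of_pos (div_pos hcn hn1)
          refine le_trans ?_ this
          rw [inv_div, show 1 - (n + 1) / (c + n) = -((1 - c) / (c + n)) by field_simp; ring,
            neg_le_neg_iff]
          have : (1 - c) / (c + n) ≤ |c - 1| / (δ * (n + 1)) := by
            refine div_le_div₀ (abs_nonneg _) ?_ (by positivity) hcn'
            rw [abs_sub_comm]
            exact le_abs_self _
          refine this.trans ?_
          rw [← div_div, add_div]
          have : 0 ≤ |c - 1| / (n + 1) := by positivity
          linarith
        · have := Real.log_le_sub_one_of_pos (div_pos hcn hn1)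
          refine this.trans ?_
          rw [show (c + n) / (n + 1) - 1 = (c - 1) / (n + 1) by field_simp; ring]
          gcongr
          have : 0 ≤ |c - 1| / δ := by positivity
          linarith [le_abs_self (c - 1)]
      have h2 : |1 - n * Real.log ((n + 1) / n)| ≤ 1 / (n + 1) := by
        rcases hn.eq_or_lt with h | h
        · rw [← h]; simp
        · have h3 := Real.one_sub_inv_le_log_of_pos (div_pos hn1 h)
          have h4 := Real.log_le_sub_one_of_pos (div_pos hn1 h)
          have h5 : n * Real.log ((n + 1) / n) ≤ 1 := by
            calc n * Real.log ((n + 1) / n) ≤ n * ((n + 1) / n - 1) := by gcongr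
              _ = 1 := by field_simp; ring
          have h6 : 1 - 1 / ((n : ℝ) + 1) ≤ n * Real.log ((n + 1) / n) := by
            calc 1 - 1 / ((n : ℝ) + 1) = n * (1 - ((n + 1) / n : ℝ)⁻¹) := by field_simp; ring
              _ ≤ _ := by gcongr
          rw [abs_of_nonneg (by linarith)]
          linarith
      -- Comparison with a telescoping difference; this is the origin of the factor `2` in front of
      -- `L`.
      have h3 : 1 / ((n : ℝ) + 1) ≤ 2 * (Real.log (n + 1 + 1) - Real.log (n + 1)) := by
        rw [← Real.log_div (by positivity) (by positivity)]
        have := Real.one_sub_inv_le_log_of_pos (x := ((n : ℝ) + 1 + 1) / (n + 1)) (by positivity)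
        have h4 : 1 / ((n : ℝ) + 1) ≤ 2 * (1 - (((n : ℝ) + 1 + 1) / (n + 1))⁻¹) := by
          rw [inv_div, show 2 * (1 - ((n : ℝ) + 1) / (n + 1 + 1)) = 2 / (n + 1 + 1) by
            field_simp; ring, div_le_div_iff₀ (by positivity) (by positivity)]
          linarith
        linarith
      have e : Real.log (Real.Gamma (c + (n + 1 : ℕ))) -
          ((n + 1 : ℕ) * Real.log (n + 1 : ℕ) - (n + 1 : ℕ)) =
          (Real.log (Real.Gamma (c + n)) - (n * Real.log n - n)) +
          Real.log ((c + n) / (n + 1)) + (1 - n * Real.log ((n + 1) / n)) := by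
        rw [hG, Real.log_div hcn.ne' hn1.ne']
        push_cast
        rcases hn.eq_or_lt with h | h
        · rw [← h]; simp; ring
        · rw [Real.log_div hn1.ne' h.ne']
          ring
      rw [e]
      refine (abs_add_three _ _ _).trans ?_
      have h4 : (|c - 1| / δ + |c - 1|) / (n + 1) + 1 / ((n : ℝ) + 1) = L * (1 / (n + 1)) := by
        rw [hL]; ring
      have h5 := mul_le_mul_of_nonneg_left h3 hL0
      push_cast
      linarith
  refine ⟨|Real.log (Real.Gamma c)| + 2 * L, by positivity, fun n => (step n).trans ?_⟩
  have h1 : 0 ≤ Real.log ((n : ℝ) + 1) := Real.log_nonneg (by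
    have : (0 : ℝ) ≤ n := Nat.cast_nonneg n
    linarith)
  nlinarith [abs_nonneg (Real.log (Real.Gamma c)), mul_nonneg
    (abs_nonneg (Real.log (Real.Gamma c))) h1]


/-! ### Expectations of functions of the empirical frequencies -/

/-- The relative frequency of the value `c`. -/
noncomputable def freq {α : Type*} [DecidableEq α] {N : ℕ} (x : Fin N → α) (c : α) : ℝ :=
  count x c / N

lemma freq_nonneg {α : Type*} [DecidableEq α] {N : ℕ} (x : Fin N → α) (c : α) : 0 ≤ freq x c := by
  unfold freq
  positivity

section LLN

variable {α : Type*} [Fintype α] [DecidableEq α] [MeasurableSpace α]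
  (Q : Measure α) [IsProbabilityMeasure Q]

/-- Impossible cells are exactly empty, not merely rare. The limit of the BGe score for constant
`X₁` makes use of this. -/
lemma ae_freq_eq_zero {N : ℕ} :
    ∀ᵐ x ∂(Measure.pi fun _ : Fin N => Q), ∀ c, Q.real {c} = 0 → freq x c = 0 := by
  rw [ae_all_iff]
  intro c
  by_cases hc : Q.real {c} = 0
  · have h1 : ∀ᵐ ω ∂Q, ω ≠ c := by
      rw [ae_iff]
      simpa [measureReal_def, ENNReal.toReal_eq_zero_iff] using hc
    have h2 : ∀ᵐ x ∂(Measure.pi fun _ : Fin N => Q), ∀ i, x i ≠ c := by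
      rw [ae_all_iff]
      intro i
      exact (Measure.tendsto_eval_ae_ae (μ := fun _ : Fin N => Q) (i := i)).eventually h1
    filter_upwards [h2] with x hx _
    have : count x c = 0 := by
      rw [count, Finset.card_eq_zero, Finset.filter_eq_empty_iff]
      exact fun i _ => hx i
    simp [freq, this]
  · exact ae_of_all _ fun x h => absurd h hc

variable [MeasurableSingletonClass α]

/-- Chebyshev's inequality for a sum of independent indicators, each of variance at most `1 / 4`.
The rate `1 / N` is what counts, not the constant. -/
lemma measureReal_abs_freq_sub_ge_le {N : ℕ} (hN : 0 < N) (c : α) {δ : ℝ} (hδ : 0 < δ) :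
    (Measure.pi fun _ : Fin N => Q).real {x | δ ≤ |freq x c - Q.real {c}|} ≤
      1 / (N * δ ^ 2) := by
  have hN' : (0 : ℝ) < N := by exact_mod_cast hN
  let X : α → ℝ := fun ω => if ω = c then 1 else 0
  let Y : (Fin N → α) → ℝ := ∑ i, fun x => X (x i)
  have hY : ∀ x, Y x = count x c := by
    intro x
    simp [Y, X, count]
  have hX : MemLp X 2 Q := MemLp.of_bound (by fun_prop) 1 (ae_of_all _ fun ω => by
    simp only [X]
    split_ifs <;> simp)
  have hvar : Var[Y; Measure.pi fun _ : Fin N => Q] ≤ N := by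
    have h1 : Var[Y; Measure.pi fun _ : Fin N => Q] = ∑ _i : Fin N, Var[X; Q] :=
      variance_sum_pi (X := fun _ => X) fun _ => hX
    have h2 : Var[X; Q] ≤ ((1 - 0) / 2) ^ 2 :=
      variance_le_sq_of_bounded (ae_of_all _ fun ω => by
        simp only [X]
        split_ifs <;> simp) (by fun_prop)
    rw [h1, Finset.sum_const, Finset.card_univ, Fintype.card_fin, nsmul_eq_mul]
    nlinarith
  have hmean : ∫ x, Y x ∂(Measure.pi fun _ : Fin N => Q) = N * Q.real {c} := by
    simp only [Y, Finset.sum_apply]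
    rw [integral_finsetSum _ fun i _ => Integrable.of_finite]
    have : ∀ i : Fin N, ∫ x, X (x i) ∂(Measure.pi fun _ : Fin N => Q) = Q.real {c} := by
      intro i
      rw [integral_comp_eval (μ := fun _ : Fin N => Q) (f := X) (by fun_prop)]
      have : X = Set.indicator {c} 1 := by
        ext ω
        simp [X, Set.indicator_apply]
      rw [this, integral_indicator_one (measurableSet_singleton c)]
    simp [this]
  have hcheb := meas_ge_le_variance_div_sq (μ := Measure.pi fun _ : Fin N => Q) (X := Y)
    (MemLp.of_bound (C := N) (by fun_prop) (ae_of_all _ fun x => by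
      rw [hY, Real.norm_of_nonneg (by positivity)]
      exact_mod_cast (Finset.card_le_univ _).trans_eq (Fintype.card_fin N))) (c := N * δ)
      (by positivity)
  have hset : {x : Fin N → α | δ ≤ |freq x c - Q.real {c}|} =
      {x | N * δ ≤ |Y x - ∫ x, Y x ∂(Measure.pi fun _ : Fin N => Q)|} := by
    ext x
    simp only [Set.mem_ofPred_eq]
    rw [hmean, hY, freq, show (count x c : ℝ) - N * Q.real {c} =
      N * (count x c / N - Q.real {c}) by field_simp, abs_mul, abs_of_pos hN',
      mul_le_mul_iff_right₀ hN']
  rw [hset, measureReal_def]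
  refine ENNReal.toReal_le_of_le_ofReal (by positivity) (hcheb.trans ?_)
  refine ENNReal.ofReal_le_ofReal ?_
  rw [div_le_div_iff₀ (by positivity) (by positivity)]
  have : 0 < (N : ℝ) * δ ^ 2 := by positivity
  nlinarith

/-- The frequency vectors that are possible under `Q`. -/
def freqSupport : Set (α → ℝ) := {f | ∀ c, 0 ≤ f c ∧ (Q.real {c} = 0 → f c = 0)}

/-- If `F N` is uniformly close to a function `Φ N` of the empirical frequencies which converges
near the true probabilities and is bounded by `o(N)`, then the expectation of `F N` converges. -/
theorem tendsto_integral_of_freq {F : ∀ N : ℕ, (Fin N → α) → ℝ} {Φ : ℕ → (α → ℝ) → ℝ} {L : ℝ}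
    {B e : ℕ → ℝ}
    (hΦ : Tendsto (fun z : ℕ × (α → ℝ) => Φ z.1 z.2)
      (atTop ×ˢ 𝓝[freqSupport Q] (fun c => Q.real {c})) (𝓝 L))
    (hB : ∀ᶠ N in atTop, ∀ x : Fin N → α, |Φ N (freq x)| ≤ B N)
    (hB0 : Tendsto (fun N => B N / N) atTop (𝓝 0))
    (hF : ∀ᶠ N in atTop, ∀ x : Fin N → α, |F N x - Φ N (freq x)| ≤ e N)
    (he : Tendsto e atTop (𝓝 0)) :
    Tendsto (fun N => ∫ x, F N x ∂(Measure.pi fun _ : Fin N => Q)) atTop (𝓝 L) := by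
  rw [Metric.tendsto_atTop']
  intro ε hε
  obtain ⟨pa, ha, pb, hb, hab⟩ := eventually_prod_iff.1
    (hΦ.eventually (Metric.ball_mem_nhds L (by positivity : 0 < ε / 3)))
  obtain ⟨δ, hδ, hball⟩ := Metric.mem_nhdsWithin_iff.1 hb
  have hlim : Tendsto (fun N : ℕ => (B N / N + |L| / N) * (Fintype.card α / δ ^ 2)) atTop
      (𝓝 ((0 + 0) * (Fintype.card α / δ ^ 2))) :=
    (hB0.add (tendsto_const_div_atTop_nhds_zero_nat _)).mul_const _
  rw [add_zero, zero_mul] at hlim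
  have hev := ((((ha.and hB).and hF).and (he.eventually_lt_const (by positivity : 0 < ε / 3))).and
    (hlim.eventually_lt_const (by positivity : 0 < ε / 3))).and (eventually_gt_atTop 0)
  obtain ⟨N₀, hN₀⟩ := eventually_atTop.1 hev
  refine ⟨N₀, fun N hN => ?_⟩
  obtain ⟨⟨⟨⟨⟨hpa, hBN⟩, hFN⟩, heN⟩, hlN⟩, hNpos⟩ := hN₀ N hN.le
  have hN' : (0 : ℝ) < N := by exact_mod_cast hNpos
  set P := Measure.pi fun _ : Fin N => Q with hP
  -- Almost surely off this set, `Φ N` is within `ε / 3` of `L`. On it the crude bound `B N + |L|`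
  -- is multiplied by a probability `O(1 / N)`, which `hB0` makes negligible.
  let bad : Set (Fin N → α) := ⋃ c, {x | δ ≤ |freq x c - Q.real {c}|}
  have hbad : P.real bad ≤ Fintype.card α / (N * δ ^ 2) := by
    refine (measureReal_iUnion_fintype_le _).trans ?_
    refine (Finset.sum_le_sum fun c _ => measureReal_abs_freq_sub_ge_le Q hNpos c hδ).trans ?_
    rw [Finset.sum_const, Finset.card_univ, nsmul_eq_mul, mul_one_div]
  obtain ⟨x₀, -⟩ : ∃ x : Fin N → α, True := by
    have : Nonempty α := Q.nonempty_of_neZero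
    exact ⟨fun _ => Classical.arbitrary α, trivial⟩
  have hB0N : 0 ≤ B N + |L| :=
    add_nonneg ((abs_nonneg _).trans (hBN x₀)) (abs_nonneg _)
  have hpt : ∀ᵐ x ∂P, |F N x - L| ≤ (e N + ε / 3) + bad.indicator (fun _ => B N + |L|) x := by
    filter_upwards [ae_freq_eq_zero Q] with x hx
    have h1 : |F N x - L| ≤ |F N x - Φ N (freq x)| + |Φ N (freq x) - L| := abs_sub_le _ _ _
    by_cases hxb : x ∈ bad
    · rw [Set.indicator_of_mem hxb]
      have h2 : |Φ N (freq x) - L| ≤ |Φ N (freq x)| + |L| := abs_sub _ _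
      linarith [hFN x, hBN x]
    · rw [Set.indicator_of_notMem hxb]
      have hmem : freq x ∈ Metric.ball (fun c => Q.real {c}) δ ∩ freqSupport Q := by
        refine ⟨?_, fun c => ⟨freq_nonneg x c, hx c⟩⟩
        rw [Metric.mem_ball, dist_pi_lt_iff hδ]
        intro c
        rw [Real.dist_eq]
        by_contra h
        exact hxb (Set.mem_iUnion.2 ⟨c, not_lt.1 h⟩)
      have h2 := hab hpa (hball hmem)
      rw [Real.dist_eq] at h2
      linarith [hFN x]
  rw [Real.dist_eq]
  have hsub : ∫ x, F N x ∂P - L = ∫ x, (F N x - L) ∂P := by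
    rw [integral_sub Integrable.of_finite Integrable.of_finite]
    simp
  rw [hsub]
  calc |∫ x, (F N x - L) ∂P| ≤ ∫ x, |F N x - L| ∂P := abs_integral_le_integral_abs
    _ ≤ ∫ x, ((e N + ε / 3) + bad.indicator (fun _ => B N + |L|) x) ∂P :=
      integral_mono_ae Integrable.of_finite Integrable.of_finite hpt
    _ = (e N + ε / 3) + P.real bad * (B N + |L|) := by
      rw [integral_add Integrable.of_finite Integrable.of_finite,
        integral_indicator_const _ (Set.toFinite bad).measurableSet]
      simp
    _ ≤ (e N + ε / 3) + Fintype.card α / (N * δ ^ 2) * (B N + |L|) := by gcongr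
    _ = (e N + ε / 3) + (B N / N + |L| / N) * (Fintype.card α / δ ^ 2) := by
      field_simp
    _ < ε := by linarith

/-- Divergent version of `tendsto_integral_of_freq`. -/
theorem tendsto_integral_atTop_of_freq {F : ∀ N : ℕ, (Fin N → α) → ℝ} {Φ : ℕ → (α → ℝ) → ℝ}
    {B e : ℕ → ℝ}
    (hΦ : Tendsto (fun z : ℕ × (α → ℝ) => Φ z.1 z.2)
      (atTop ×ˢ 𝓝[freqSupport Q] (fun c => Q.real {c})) atTop)
    (hB : ∀ᶠ N in atTop, ∀ x : Fin N → α, |Φ N (freq x)| ≤ B N)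
    (hB0 : Tendsto (fun N => B N / N) atTop (𝓝 0))
    (hF : ∀ᶠ N in atTop, ∀ x : Fin N → α, |F N x - Φ N (freq x)| ≤ e N)
    (he : Tendsto e atTop (𝓝 0)) :
    Tendsto (fun N => ∫ x, F N x ∂(Measure.pi fun _ : Fin N => Q)) atTop atTop := by
  rw [tendsto_atTop]
  intro A
  -- Truncation makes the limit finite, and the distance of `F` and `Φ` does not grow under it. The
  -- level `A + 1` leaves room for the integrals to exceed `A` eventually.
  have h := tendsto_integral_of_freq Q (F := fun N x => min (F N x) (A + 1))
    (Φ := fun N f => min (Φ N f) (A + 1)) (L := A + 1) (B := fun N => B N + |A + 1|) (e := e)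
    ?_ ?_ ?_ ?_ he
  · filter_upwards [h.eventually_const_lt (lt_add_one A)] with N hN
    exact hN.le.trans (integral_mono Integrable.of_finite Integrable.of_finite
      fun x => min_le_left _ _)
  · refine tendsto_const_nhds.congr' ?_
    filter_upwards [hΦ.eventually_ge_atTop (A + 1)] with z hz
    exact (min_eq_right hz).symm
  · filter_upwards [hB] with N hN x
    exact (abs_min_le_max_abs_abs).trans (max_le
      ((hN x).trans (le_add_of_nonneg_right (abs_nonneg _)))
      (le_add_of_nonneg_left ((abs_nonneg _).trans (hN x))))
  · simp_rw [add_div]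
    simpa using hB0.add (tendsto_const_div_atTop_nhds_zero_nat |A + 1|)
  · filter_upwards [hF] with N hN x
    exact (abs_min_sub_min_le_max _ _ _ _).trans (max_le (hN x)
      (by simpa using (abs_nonneg _).trans (hN x)))

end LLN

/-! ### Logarithmic errors, prior odds and the true cell probabilities -/

lemma tendsto_log_add_div {c : ℝ} :
    Tendsto (fun N : ℕ => Real.log (c + N) / N) atTop (𝓝 0) := by
  have h1 : Tendsto (fun N : ℕ => c + (N : ℝ)) atTop atTop :=
    tendsto_atTop_add_const_left _ _ tendsto_natCast_atTop_atTop
  have h2 : Tendsto (fun N : ℕ => Real.log (c + N) / (c + N)) atTop (𝓝 0) :=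
    (Real.isLittleO_log_id_atTop.tendsto_div_nhds_zero).comp h1
  have h3 : Tendsto (fun N : ℕ => c / N + 1) atTop (𝓝 (0 + 1)) :=
    (tendsto_const_div_atTop_nhds_zero_nat c).add_const 1
  have h4 := h2.mul h3
  rw [zero_mul] at h4
  refine h4.congr' ?_
  filter_upwards [eventually_gt_atTop 0, h1.eventually_gt_atTop 0] with N hN hc
  have : (0 : ℝ) < N := by exact_mod_cast hN
  field_simp

/-- The normalizing sum cancels, and the prior enters as an additive constant that vanishes after
division by `N`. -/
lemma log_posterior_ratio {q m₁ m₀ : ℝ} (hq0 : 0 < q) (hq1 : q < 1) (h₁ : 0 < m₁) (h₀ : 0 < m₀) :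
    Real.log (posteriorEdge q m₁ m₀ / posteriorEmpty q m₁ m₀) =
      Real.log (m₁ / m₀) + Real.log (q / (1 - q)) := by
  have hq : 0 < 1 - q := by linarith
  have hs : 0 < m₁ * q + m₀ * (1 - q) := by positivity
  rw [← Real.log_mul (by positivity) (by positivity), posteriorEdge, posteriorEmpty]
  congr 1
  field_simp

instance (p β : unitInterval) : IsProbabilityMeasure (sddLaw p β) := by
  unfold sddLaw
  have : IsMarkovKernel (Kernel.ofFunOfCountable fun x₁ =>
      bernoulliMeasure true false (childProb β x₁)) :=
    ⟨fun x₁ => by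
      change IsProbabilityMeasure (bernoulliMeasure true false (childProb β x₁))
      infer_instance⟩
  infer_instance

lemma sddLaw_singleton (p β : unitInterval) :
    (sddLaw p β).real {(true, true)} = (p : ℝ) * (1 / 2 + (β : ℝ) / 2) ∧
    (sddLaw p β).real {(true, false)} = (p : ℝ) * (1 / 2 - (β : ℝ) / 2) ∧
    (sddLaw p β).real {(false, true)} = (1 - (p : ℝ)) * (1 / 2 - (β : ℝ) / 2) ∧
    (sddLaw p β).real {(false, false)} = (1 - (p : ℝ)) * (1 / 2 + (β : ℝ) / 2) := by
  have : IsMarkovKernel (Kernel.ofFunOfCountable fun x₁ =>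
      bernoulliMeasure true false (childProb β x₁)) :=
    ⟨fun x₁ => by
      change IsProbabilityMeasure (bernoulliMeasure true false (childProb β x₁))
      infer_instance⟩
  have key : ∀ a b : Bool, (sddLaw p β).real {(a, b)} =
      (bernoulliMeasure true false p).real {a} *
        (bernoulliMeasure true false (childProb β a)).real {b} := by
    intro a b
    rw [measureReal_def, sddLaw, ← Set.singleton_prod_singleton,
      Measure.compProd_apply_prod (measurableSet_singleton a) (measurableSet_singleton b),
      lintegral_singleton, ENNReal.toReal_mul, mul_comm]
    rfl
  simp only [key, bernoulliMeasure_real_apply _ (measurableSet_singleton _)]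
  simp [childProb]
  ring_nf
  simp


/-! ### The BGe score of binary data -/

/-- First diagonal entry of the posterior matrix for a `2 × 2` table with entries `a, b, c, d`. -/
noncomputable def tableVar₁ (t a b c d : ℝ) : ℝ := t + (a + b) * (c + d) / (a + b + c + d)

/-- Second diagonal entry of the posterior matrix for a `2 × 2` table. -/
noncomputable def tableVar₂ (t a b c d : ℝ) : ℝ := t + (a + c) * (b + d) / (a + b + c + d)

/-- Off-diagonal entry of the posterior matrix for a `2 × 2` table. -/
noncomputable def tableCov (a b c d : ℝ) : ℝ := (a * d - b * c) / (a + b + c + d)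

/-- Determinant of the posterior matrix for a `2 × 2` table. -/
noncomputable def tableDet (t a b c d : ℝ) : ℝ :=
  tableVar₁ t a b c d * tableVar₂ t a b c d - tableCov a b c d ^ 2

/-- Logarithm of the inverse of one minus the squared posterior correlation of a table. -/
noncomputable def tableCorr (t a b c d : ℝ) : ℝ :=
  Real.log (tableVar₁ t a b c d * tableVar₂ t a b c d / tableDet t a b c d)

section Table

variable {t a b c d : ℝ}

lemma le_tableVar₁ (ha : 0 ≤ a) (hb : 0 ≤ b) (hc : 0 ≤ c) (hd : 0 ≤ d) :
    t ≤ tableVar₁ t a b c d := by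
  unfold tableVar₁
  have : 0 ≤ (a + b) * (c + d) / (a + b + c + d) := by positivity
  linarith

lemma le_tableVar₂ (ha : 0 ≤ a) (hb : 0 ≤ b) (hc : 0 ≤ c) (hd : 0 ≤ d) :
    t ≤ tableVar₂ t a b c d := by
  unfold tableVar₂
  have : 0 ≤ (a + c) * (b + d) / (a + b + c + d) := by positivity
  linarith

/-- Expanding in `t` leaves `t²`, a nonnegative multiple of `t`, and the determinant of the scatter
matrix. The numerator of the latter expands to a polynomial in the cells with nonnegative
coefficients. The bound keeps the logarithm of the determinant under control for all data. -/
lemma sq_le_tableDet (ht : 0 ≤ t) (ha : 0 ≤ a) (hb : 0 ≤ b) (hc : 0 ≤ c) (hd : 0 ≤ d) :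
    t ^ 2 ≤ tableDet t a b c d := by
  have e : tableDet t a b c d = t ^ 2 + t * ((a + b) * (c + d) / (a + b + c + d) +
      (a + c) * (b + d) / (a + b + c + d)) +
      ((a + b) * (c + d) * ((a + c) * (b + d)) - (a * d - b * c) ^ 2) / (a + b + c + d) ^ 2 := by
    unfold tableDet tableVar₁ tableVar₂ tableCov
    generalize a + b + c + d = M
    ring
  rw [e]
  have h1 : 0 ≤ t * ((a + b) * (c + d) / (a + b + c + d) +
      (a + c) * (b + d) / (a + b + c + d)) := by positivity
  have h2 : 0 ≤ ((a + b) * (c + d) * ((a + c) * (b + d)) - (a * d - b * c) ^ 2) /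
      (a + b + c + d) ^ 2 := by
    refine div_nonneg ?_ (by positivity)
    ring_nf
    positivity
  linarith

/-- Homogeneity of degree zero permits division by `N`: counts become frequencies, and the prior
survives only as `t / N` and `am / N`. -/
lemma tableCorr_smul {k : ℝ} (hk : k ≠ 0) :
    tableCorr (k * t) (k * a) (k * b) (k * c) (k * d) = tableCorr t a b c d := by
  have h1 : tableVar₁ (k * t) (k * a) (k * b) (k * c) (k * d) = k * tableVar₁ t a b c d := by
    unfold tableVar₁
    rw [show k * a + k * b + k * c + k * d = k * (a + b + c + d) by ring,
      show (k * a + k * b) * (k * c + k * d) = k * (k * ((a + b) * (c + d))) by ring,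
      mul_div_mul_left _ _ hk]
    ring
  have h2 : tableVar₂ (k * t) (k * a) (k * b) (k * c) (k * d) = k * tableVar₂ t a b c d := by
    unfold tableVar₂
    rw [show k * a + k * b + k * c + k * d = k * (a + b + c + d) by ring,
      show (k * a + k * c) * (k * b + k * d) = k * (k * ((a + c) * (b + d))) by ring,
      mul_div_mul_left _ _ hk]
    ring
  have h3 : tableCov (k * a) (k * b) (k * c) (k * d) = k * tableCov a b c d := by
    unfold tableCov
    rw [show k * a + k * b + k * c + k * d = k * (a + b + c + d) by ring,
      show k * a * (k * d) - k * b * (k * c) = k * (k * (a * d - b * c)) by ring,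
      mul_div_mul_left _ _ hk]
    ring
  unfold tableCorr tableDet
  rw [h1, h2, h3, show k * tableVar₁ t a b c d * (k * tableVar₂ t a b c d) -
    (k * tableCov a b c d) ^ 2 = k ^ 2 * (tableVar₁ t a b c d * tableVar₂ t a b c d -
      tableCov a b c d ^ 2) by ring, show k * tableVar₁ t a b c d * (k * tableVar₂ t a b c d) =
      k ^ 2 * (tableVar₁ t a b c d * tableVar₂ t a b c d) by ring,
    mul_div_mul_left _ _ (pow_ne_zero 2 hk)]

lemma tableCorr_nonneg (ht : 0 < t) (ha : 0 ≤ a) (hb : 0 ≤ b) (hc : 0 ≤ c) (hd : 0 ≤ d) :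
    0 ≤ tableCorr t a b c d := by
  have h := sq_le_tableDet ht.le ha hb hc hd
  have hD : 0 < tableDet t a b c d := lt_of_lt_of_le (by positivity) h
  refine Real.log_nonneg ?_
  rw [one_le_div hD, tableDet]
  linarith [sq_nonneg (tableCov a b c d)]

end Table

section TableLimits

variable {ι : Type*} {l : Filter ι} {e a b c d : ι → ℝ} {t am a₀ b₀ c₀ d₀ : ℝ}

/-- In this lemma and the next ones `e` plays the role of `1 / N`, so `t * e` and `am * e` are the
fading prior terms. -/
lemma tendsto_tableVar₁ (he : Tendsto e l (𝓝 0)) (ha : Tendsto a l (𝓝 a₀))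
    (hb : Tendsto b l (𝓝 b₀)) (hc : Tendsto c l (𝓝 c₀)) (hd : Tendsto d l (𝓝 d₀))
    (hs : a₀ + b₀ + c₀ + d₀ = 1) :
    Tendsto (fun i => tableVar₁ (t * e i) (a i) (b i) (c i) (d i + am * e i)) l
      (𝓝 ((a₀ + b₀) * (c₀ + d₀))) := by
  have hd' : Tendsto (fun i => d i + am * e i) l (𝓝 d₀) := by
    simpa using hd.add (he.const_mul am)
  have h := (he.const_mul t).add
    (((ha.add hb).mul (hc.add hd')).div (((ha.add hb).add hc).add hd')
      (by rw [hs]; exact one_ne_zero))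
  rw [hs, div_one, mul_zero, zero_add] at h
  exact h

lemma tendsto_tableVar₂ (he : Tendsto e l (𝓝 0)) (ha : Tendsto a l (𝓝 a₀))
    (hb : Tendsto b l (𝓝 b₀)) (hc : Tendsto c l (𝓝 c₀)) (hd : Tendsto d l (𝓝 d₀))
    (hs : a₀ + b₀ + c₀ + d₀ = 1) :
    Tendsto (fun i => tableVar₂ (t * e i) (a i) (b i) (c i) (d i + am * e i)) l
      (𝓝 ((a₀ + c₀) * (b₀ + d₀))) := by
  have hd' : Tendsto (fun i => d i + am * e i) l (𝓝 d₀) := by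
    simpa using hd.add (he.const_mul am)
  have h := (he.const_mul t).add
    (((ha.add hc).mul (hb.add hd')).div (((ha.add hb).add hc).add hd')
      (by rw [hs]; exact one_ne_zero))
  rw [hs, div_one, mul_zero, zero_add] at h
  exact h

lemma tendsto_tableDet (he : Tendsto e l (𝓝 0)) (ha : Tendsto a l (𝓝 a₀))
    (hb : Tendsto b l (𝓝 b₀)) (hc : Tendsto c l (𝓝 c₀)) (hd : Tendsto d l (𝓝 d₀))
    (hs : a₀ + b₀ + c₀ + d₀ = 1) :
    Tendsto (fun i => tableDet (t * e i) (a i) (b i) (c i) (d i + am * e i)) l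
      (𝓝 ((a₀ + b₀) * (c₀ + d₀) * ((a₀ + c₀) * (b₀ + d₀)) - (a₀ * d₀ - b₀ * c₀) ^ 2)) := by
  have hd' : Tendsto (fun i => d i + am * e i) l (𝓝 d₀) := by
    simpa using hd.add (he.const_mul am)
  have h := ((ha.mul hd').sub (hb.mul hc)).div (((ha.add hb).add hc).add hd')
    (by rw [hs]; exact one_ne_zero)
  rw [hs, div_one] at h
  exact ((tendsto_tableVar₁ he ha hb hc hd hs).mul (tendsto_tableVar₂ he ha hb hc hd hs)).sub
    (h.pow 2)

/-- Limit of the empirical correlation when the limiting covariance matrix is nonsingular. -/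
lemma tendsto_tableCorr_of_pos (he : Tendsto e l (𝓝 0)) (ha : Tendsto a l (𝓝 a₀))
    (hb : Tendsto b l (𝓝 b₀)) (hc : Tendsto c l (𝓝 c₀)) (hd : Tendsto d l (𝓝 d₀))
    (hs : a₀ + b₀ + c₀ + d₀ = 1)
    (hD : 0 < (a₀ + b₀) * (c₀ + d₀) * ((a₀ + c₀) * (b₀ + d₀)) - (a₀ * d₀ - b₀ * c₀) ^ 2) :
    Tendsto (fun i => tableCorr (t * e i) (a i) (b i) (c i) (d i + am * e i)) l
      (𝓝 (Real.log ((a₀ + b₀) * (c₀ + d₀) * ((a₀ + c₀) * (b₀ + d₀)) /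
        ((a₀ + b₀) * (c₀ + d₀) * ((a₀ + c₀) * (b₀ + d₀)) - (a₀ * d₀ - b₀ * c₀) ^ 2)))) := by
  refine (((tendsto_tableVar₁ he ha hb hc hd hs).mul (tendsto_tableVar₂ he ha hb hc hd hs)).div
    (tendsto_tableDet he ha hb hc hd hs) hD.ne').log (div_pos ?_ hD).ne'
  linarith [sq_nonneg (a₀ * d₀ - b₀ * c₀)]

/-- The empirical correlation vanishes in the limit when the first variable is constant. -/
lemma tendsto_tableCorr_of_degenerate (ht : 0 < t) (ham : 0 < am)
    (he : Tendsto e l (𝓝 0)) (ha : Tendsto a l (𝓝 a₀))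
    (hb : Tendsto b l (𝓝 b₀)) (hc : Tendsto c l (𝓝 c₀)) (hd : Tendsto d l (𝓝 d₀))
    (hs : a₀ + b₀ + c₀ + d₀ = 1) (h₀ : 0 ≤ a₀ + b₀) (hv : 0 < (a₀ + c₀) * (b₀ + d₀))
    (he0 : ∀ᶠ i in l, e i ≠ 0)
    (hdeg : (∀ᶠ i in l, a i = 0 ∧ b i = 0) ∨ ∀ᶠ i in l, c i = 0 ∧ d i = 0) :
    Tendsto (fun i => tableCorr (t * e i) (a i) (b i) (c i) (d i + am * e i)) l (𝓝 0) := by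
  have hd' : Tendsto (fun i => d i + am * e i) l (𝓝 d₀) := by
    simpa using hd.add (he.const_mul am)
  have hM : Tendsto (fun i => a i + b i + c i + (d i + am * e i)) l (𝓝 1) := by
    have := ((ha.add hb).add hc).add hd'
    rwa [hs] at this
  have hB : Tendsto (fun i => t + (a i + b i) * am / (a i + b i + c i + (d i + am * e i))) l
      (𝓝 (t + (a₀ + b₀) * am / 1)) :=
    tendsto_const_nhds.add (((ha.add hb).mul_const am).div hM one_ne_zero)
  have hA : Tendsto (fun i => a i * am / (a i + b i + c i + (d i + am * e i))) l
      (𝓝 (a₀ * am / 1)) := (ha.mul_const am).div hM one_ne_zero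
  have hBV := hB.mul (tendsto_tableVar₂ (t := t) (am := am) he ha hb hc hd hs)
  have hpos : 0 < (t + (a₀ + b₀) * am / 1) * ((a₀ + c₀) * (b₀ + d₀)) := by positivity
  have hden := hBV.sub (he.mul (hA.pow 2))
  rw [zero_mul, sub_zero] at hden
  have h := (hBV.div hden hpos.ne').log (by rw [div_self hpos.ne']; exact one_ne_zero)
  rw [div_self hpos.ne', Real.log_one] at h
  refine h.congr' ?_
  have hdeg' : ∀ᶠ i in l, (a i = 0 ∧ b i = 0) ∨ (c i = 0 ∧ d i = 0) :=
    hdeg.elim (fun h => h.mono fun _ => Or.inl) fun h => h.mono fun _ => Or.inr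
  filter_upwards [he0, hdeg'] with i hi hor
  -- With one row of the table empty, the first variance and the covariance are both exact multiples
  -- of `e i`. One factor `e i` cancels from the quotient `0 / 0`, and the covariance keeps another
  -- one that tends to zero.
  have h1 : tableVar₁ (t * e i) (a i) (b i) (c i) (d i + am * e i) =
      e i * (t + (a i + b i) * am / (a i + b i + c i + (d i + am * e i))) := by
    unfold tableVar₁
    rcases hor with ⟨h1, h2⟩ | ⟨h1, h2⟩ <;> rw [h1, h2] <;> ring
  have h2 : tableCov (a i) (b i) (c i) (d i + am * e i) =
      e i * (a i * am / (a i + b i + c i + (d i + am * e i))) := by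
    unfold tableCov
    rcases hor with ⟨h1, h2⟩ | ⟨h1, h2⟩ <;> rw [h1, h2] <;> ring
  unfold tableCorr tableDet
  rw [h1, h2, mul_assoc (e i), show ∀ A B V : ℝ, e i * (B * V) - (e i * A) ^ 2 =
    e i * (B * V - e i * A ^ 2) by intros; ring, mul_div_mul_left _ _ hi]
  rfl

/-- The logarithm diverges when the limiting covariance matrix is singular. -/
lemma tendsto_tableCorr_atTop (ht : 0 < t) (ham : 0 < am)
    (he : Tendsto e l (𝓝 0)) (ha : Tendsto a l (𝓝 a₀))
    (hb : Tendsto b l (𝓝 b₀)) (hc : Tendsto c l (𝓝 c₀)) (hd : Tendsto d l (𝓝 d₀))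
    (hs : a₀ + b₀ + c₀ + d₀ = 1)
    (hD : (a₀ + b₀) * (c₀ + d₀) * ((a₀ + c₀) * (b₀ + d₀)) - (a₀ * d₀ - b₀ * c₀) ^ 2 = 0)
    (hV : 0 < (a₀ + b₀) * (c₀ + d₀) * ((a₀ + c₀) * (b₀ + d₀)))
    (hpos : ∀ᶠ i in l, 0 < e i ∧ 0 ≤ a i ∧ 0 ≤ b i ∧ 0 ≤ c i ∧ 0 ≤ d i) :
    Tendsto (fun i => tableCorr (t * e i) (a i) (b i) (c i) (d i + am * e i)) l atTop := by
  have h1 := (tendsto_tableVar₁ (t := t) (am := am) he ha hb hc hd hs).mul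
    (tendsto_tableVar₂ (t := t) (am := am) he ha hb hc hd hs)
  have h2 := tendsto_tableDet (t := t) (am := am) he ha hb hc hd hs
  rw [hD] at h2
  -- The prior keeps the determinant above `(t * e i)²`, so it approaches zero from the right.
  have h3 : Tendsto (fun i => tableDet (t * e i) (a i) (b i) (c i) (d i + am * e i)) l
      (𝓝[>] 0) := by
    refine tendsto_nhdsWithin_iff.2 ⟨h2, ?_⟩
    filter_upwards [hpos] with i hi
    obtain ⟨hi0, hi1, hi2, hi3, hi4⟩ := hi
    exact lt_of_lt_of_le (by positivity)
      (sq_le_tableDet (by positivity) hi1 hi2 hi3 (by positivity))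
  exact Real.tendsto_log_atTop.comp (h1.pos_mul_atTop hV h3.inv_tendsto_nhdsGT_zero)

end TableLimits

/-- The prior on the mean acts like `am` extra observations at `(0, 0)`: they contribute nothing to
the sums and only raise the sample size to `am + N`. This is why `am` is added to the last cell. -/
lemma scatter_asReal (am : ℝ) {N : ℕ} (x : Fin N → Bool × Bool) (hM : 0 < am + N) (t : ℝ) :
    t + scatter am (asReal x) 0 0 = tableVar₁ t (count x (true, true)) (count x (true, false))
      (count x (false, true)) (count x (false, false) + am) ∧
    t + scatter am (asReal x) 1 1 = tableVar₂ t (count x (true, true)) (count x (true, false))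
      (count x (false, true)) (count x (false, false) + am) ∧
    scatter am (asReal x) 0 1 = tableCov (count x (true, true)) (count x (true, false))
      (count x (false, true)) (count x (false, false) + am) := by
  have hN := sum_count x
  have h0 := sum_comp_eq_sum_count_mul x fun c => if c.1 then (1 : ℝ) else 0
  have h1 := sum_comp_eq_sum_count_mul x fun c => if c.2 then (1 : ℝ) else 0
  have h00 := sum_comp_eq_sum_count_mul x fun c =>
    (if c.1 then (1 : ℝ) else 0) * (if c.1 then (1 : ℝ) else 0)
  have h01 := sum_comp_eq_sum_count_mul x fun c =>
    (if c.1 then (1 : ℝ) else 0) * (if c.2 then (1 : ℝ) else 0)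
  have h11 := sum_comp_eq_sum_count_mul x fun c =>
    (if c.2 then (1 : ℝ) else 0) * (if c.2 then (1 : ℝ) else 0)
  simp only [Fintype.sum_prod_type, Fintype.sum_bool, if_true, Bool.false_eq_true, if_false,
    mul_one, mul_zero, add_zero] at hN h0 h1 h00 h01 h11
  have hM' : (count x (true, true) : ℝ) + count x (true, false) + count x (false, true) +
      (count x (false, false) + am) = am + N := by linarith
  have hd : (count x (false, false) : ℝ) = N - count x (true, true) - count x (true, false) -
    count x (false, true) := by linarith
  simp only [scatter, asReal, Matrix.cons_val_zero, Matrix.cons_val_one, Matrix.cons_val_fin_one,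
    h0, h1, h00, h01, h11, tableVar₁, tableVar₂, tableCov, hM']
  rw [hd]
  refine ⟨?_, ?_, ?_⟩ <;> field_simp <;> ring

/-- Up to a logarithmic error, the log ratio of the BGe marginal likelihoods of binary data is
determined by the correlation of the table of counts. -/
theorem exists_abs_log_bge_ratio_sub_le {am aw t : ℝ} (ham : 0 < am) (haw : 3 < aw) (ht : 0 < t) :
    ∃ K, ∀ N : ℕ, 2 ≤ N → ∀ x : Fin N → Bool × Bool,
      0 < bgeEdge am aw t (asReal x) ∧ 0 < bgeEmpty am aw t (asReal x) ∧
      |Real.log (bgeEdge am aw t (asReal x) / bgeEmpty am aw t (asReal x)) -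
        N / 2 * tableCorr t (count x (true, true)) (count x (true, false))
          (count x (false, true)) (count x (false, false) + am)| ≤
        K + |Real.log (aw + N)| + (aw + 1) * |Real.log (t + N)| ∧
      |tableCorr t (count x (true, true)) (count x (true, false))
          (count x (false, true)) (count x (false, false) + am)| ≤
        2 * |Real.log (t + N)| + 2 * |Real.log t| := by
  obtain ⟨C, hC, h⟩ := exists_bge_ratio ham haw ht
  refine ⟨|Real.log C| + (aw + 1) * |Real.log t|, fun N hN2 x => ?_⟩
  have hN : (2 : ℝ) ≤ N := by exact_mod_cast hN2
  obtain ⟨e0, e1, e01⟩ := scatter_asReal am x (by positivity) t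
  have hsum := sum_count x
  simp only [Fintype.sum_prod_type, Fintype.sum_bool] at hsum
  obtain ⟨a, ha⟩ : ∃ a : ℝ, a = count x (true, true) := ⟨_, rfl⟩
  obtain ⟨b, hb⟩ : ∃ a : ℝ, a = count x (true, false) := ⟨_, rfl⟩
  obtain ⟨c, hc⟩ : ∃ a : ℝ, a = count x (false, true) := ⟨_, rfl⟩
  obtain ⟨d, hd⟩ : ∃ a : ℝ, a = count x (false, false) := ⟨_, rfl⟩
  have ha0 : 0 ≤ a := ha ▸ Nat.cast_nonneg _
  have hb0 : 0 ≤ b := hb ▸ Nat.cast_nonneg _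
  have hc0 : 0 ≤ c := hc ▸ Nat.cast_nonneg _
  have hd0 : 0 ≤ d := hd ▸ Nat.cast_nonneg _
  rw [← ha, ← hb, ← hc, ← hd] at e0 e1 e01 hsum ⊢
  have hV1 := le_tableVar₁ (t := t) ha0 hb0 hc0 (add_nonneg hd0 ham.le)
  have hV2 := le_tableVar₂ (t := t) ha0 hb0 hc0 (add_nonneg hd0 ham.le)
  have hD := sq_le_tableDet ht.le ha0 hb0 hc0 (add_nonneg hd0 ham.le)
  have hcorr := tableCorr_nonneg ht ha0 hb0 hc0 (add_nonneg hd0 ham.le)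
  have hM : 0 < a + b + c + (d + am) := by linarith
  have hV1' : tableVar₁ t a b c (d + am) ≤ t + N := by
    unfold tableVar₁
    have : (a + b) * (c + (d + am)) / (a + b + c + (d + am)) ≤ N := by
      rw [div_le_iff₀ hM]
      exact mul_le_mul (by linarith) (by linarith) (by linarith) (by linarith)
    linarith
  have hV2' : tableVar₂ t a b c (d + am) ≤ t + N := by
    unfold tableVar₂
    have : (a + c) * (b + (d + am)) / (a + b + c + (d + am)) ≤ N := by
      rw [div_le_iff₀ hM]
      exact mul_le_mul (by linarith) (by linarith) (by linarith) (by linarith)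
    linarith
  have hDpos : 0 < tableDet t a b c (d + am) := lt_of_lt_of_le (by positivity) hD
  have hV1p := ht.trans_le hV1
  have hV2p := ht.trans_le hV2
  obtain ⟨hE, hF, hR⟩ := h N (asReal x) (by rw [e0]; exact hV1p) (by rw [e1]; exact hV2p)
    (by rw [e0, e1, e01]; exact hDpos)
  rw [e0, e1, e01] at hR
  refine ⟨hE, hF, ?_⟩
  have hG := Real.Gamma_pos_of_pos (s := (aw + N) / 2) (by linarith)
  have hG' := Real.Gamma_pos_of_pos (s := (aw + N) / 2 - 1 / 2) (by linarith)
  rw [hR]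
  change |Real.log (C * (Real.Gamma ((aw + N) / 2) / Real.Gamma ((aw + N) / 2 - 1 / 2)) *
    ((tableVar₁ t a b c (d + am) * tableVar₂ t a b c (d + am)) ^ ((aw + N) / 2 - 1 / 2) /
      tableDet t a b c (d + am) ^ ((aw + N) / 2))) - _| ≤ _ ∧ _
  set V := tableVar₁ t a b c (d + am) * tableVar₂ t a b c (d + am) with hV
  set D := tableDet t a b c (d + am) with hDdef
  have hVp : 0 < V := mul_pos hV1p hV2p
  have hcorr' : tableCorr t a b c (d + am) = Real.log V - Real.log D :=
    Real.log_div hVp.ne' hDpos.ne'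
  have hlogV : Real.log V ≤ 2 * Real.log (t + N) := by
    have := Real.log_le_log hVp (mul_le_mul hV1' hV2' hV2p.le (by linarith))
    rw [← sq, Real.log_pow] at this
    exact_mod_cast this
  have hlogD : 2 * Real.log t ≤ Real.log D := by
    have := Real.log_le_log (by positivity) hD
    rw [Real.log_pow] at this
    exact_mod_cast this
  have hlogDV : Real.log D ≤ Real.log V := by linarith
  -- Gamma is increasing from `2` on, and `N ≥ 2` with `aw > 3` puts both arguments there. The upper
  -- bound below compares with `Γ(s + 1) = s Γ(s)` at `s = (aw + N) / 2 - 1 / 2`.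
  have hGam0 : 0 ≤ Real.log (Real.Gamma ((aw + N) / 2) / Real.Gamma ((aw + N) / 2 - 1 / 2)) := by
    refine Real.log_nonneg ((one_le_div hG').2 ?_)
    exact Real.Gamma_strictMonoOn_Ici.monotoneOn (Set.mem_Ici.2 (by linarith))
      (Set.mem_Ici.2 (by linarith)) (by linarith)
  have hGam1 : Real.log (Real.Gamma ((aw + N) / 2) / Real.Gamma ((aw + N) / 2 - 1 / 2)) ≤
      |Real.log (aw + N)| := by
    refine (Real.log_le_log (by positivity) ?_).trans (le_abs_self _)
    rw [div_le_iff₀ hG']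
    have h1 : Real.Gamma ((aw + N) / 2) ≤ Real.Gamma ((aw + N) / 2 - 1 / 2 + 1) :=
      Real.Gamma_strictMonoOn_Ici.monotoneOn (Set.mem_Ici.2 (by linarith))
        (Set.mem_Ici.2 (by linarith)) (by linarith)
    rw [Real.Gamma_add_one (by linarith)] at h1
    exact h1.trans (mul_le_mul_of_nonneg_right (by linarith) hG'.le)
  have hDs := Real.rpow_pos_of_pos hDpos ((aw + N) / 2)
  have hVs := Real.rpow_pos_of_pos hVp ((aw + N) / 2 - 1 / 2)
  have hlog : Real.log (C * (Real.Gamma ((aw + N) / 2) / Real.Gamma ((aw + N) / 2 - 1 / 2)) *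
      (V ^ ((aw + N) / 2 - 1 / 2) / D ^ ((aw + N) / 2))) - N / 2 * tableCorr t a b c (d + am) =
      Real.log C + Real.log (Real.Gamma ((aw + N) / 2) / Real.Gamma ((aw + N) / 2 - 1 / 2)) +
        aw / 2 * (Real.log V - Real.log D) - 1 / 2 * Real.log V := by
    rw [hcorr', Real.log_mul (by positivity) (by positivity), Real.log_mul hC.ne' (by positivity),
      Real.log_div hVs.ne' hDs.ne', Real.log_rpow hVp, Real.log_rpow hDpos]
    ring
  have hA := le_abs_self (Real.log (t + N))
  have hB := neg_abs_le (Real.log t)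
  have hC1 := le_abs_self (Real.log C)
  have hC2 := neg_abs_le (Real.log C)
  have hp : aw / 2 * (Real.log V - Real.log D) ≤
      aw / 2 * (2 * |Real.log (t + N)| + 2 * |Real.log t|) :=
    mul_le_mul_of_nonneg_left (by linarith) (by linarith)
  have hp0 : 0 ≤ aw / 2 * (Real.log V - Real.log D) :=
    mul_nonneg (by linarith) (by linarith)
  rw [hlog]
  constructor
  · have := abs_nonneg (Real.log (t + N))
    have := abs_nonneg (Real.log (aw + N))
    have := abs_nonneg (Real.log t)
    have h1 : 0 ≤ aw * |Real.log t| := by positivity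
    have h2 : 0 ≤ aw * |Real.log (t + N)| := by positivity
    rw [abs_le]
    constructor <;> linarith
  · rw [abs_of_nonneg hcorr, hcorr']
    linarith


/-! ### The BDe score -/

/-- The empirical mutual information of a table of frequencies. -/
noncomputable def mutualInfo (f : Bool × Bool → ℝ) : ℝ :=
  f (true, true) * Real.log (f (true, true)) + f (true, false) * Real.log (f (true, false)) +
    f (false, true) * Real.log (f (false, true)) + f (false, false) * Real.log (f (false, false)) -
    (f (true, true) + f (true, false)) * Real.log (f (true, true) + f (true, false)) -
    (f (false, true) + f (false, false)) * Real.log (f (false, true) + f (false, false)) -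
    (f (true, true) + f (false, true)) * Real.log (f (true, true) + f (false, true)) -
    (f (true, false) + f (false, false)) * Real.log (f (true, false) + f (false, false))

/-- Every term has the form `s log s`, which is continuous at `0` as well. Vanishing cells and
margins thus need no separate treatment in the BDe limit. -/
lemma continuous_mutualInfo : Continuous mutualInfo := by
  have h : ∀ g : (Bool × Bool → ℝ) → ℝ, Continuous g → Continuous fun f => g f * Real.log (g f) :=
    fun g hg => Real.continuous_mul_log.comp hg
  unfold mutualInfo
  refine ((((((((h _ ?_).add (h _ ?_)).add (h _ ?_)).add (h _ ?_)).sub (h _ ?_)).sub (h _ ?_)).sub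
    (h _ ?_)).sub (h _ ?_)) <;> fun_prop

lemma abs_mul_log_le_one {x : ℝ} (h0 : 0 ≤ x) (h1 : x ≤ 1) : |x * Real.log x| ≤ 1 := by
  rcases h0.eq_or_lt with h | h
  · simp [← h]
  · rw [mul_comm]
    exact (Real.abs_log_mul_self_lt x h h1).le

lemma sum_freq {N : ℕ} (hN : 0 < N) (x : Fin N → Bool × Bool) :
    freq x (true, true) + freq x (true, false) + freq x (false, true) + freq x (false, false) =
      1 := by
  have hsum := sum_count x
  simp only [Fintype.sum_prod_type, Fintype.sum_bool] at hsum
  have hN' : (0 : ℝ) < N := by exact_mod_cast hN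
  simp only [freq]
  field_simp
  linarith

lemma abs_mutualInfo_freq_le {N : ℕ} (hN : 0 < N) (x : Fin N → Bool × Bool) :
    |mutualInfo (freq x)| ≤ 8 := by
  have hs := sum_freq hN x
  have h11 := freq_nonneg x (true, true)
  have h10 := freq_nonneg x (true, false)
  have h01 := freq_nonneg x (false, true)
  have h00 := freq_nonneg x (false, false)
  have e1 := abs_le.1 (abs_mul_log_le_one h11 (by linarith))
  have e2 := abs_le.1 (abs_mul_log_le_one h10 (by linarith))
  have e3 := abs_le.1 (abs_mul_log_le_one h01 (by linarith))
  have e4 := abs_le.1 (abs_mul_log_le_one h00 (by linarith))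
  have e5 := abs_le.1 (abs_mul_log_le_one (add_nonneg h11 h10) (by linarith))
  have e6 := abs_le.1 (abs_mul_log_le_one (add_nonneg h01 h00) (by linarith))
  have e7 := abs_le.1 (abs_mul_log_le_one (add_nonneg h11 h01) (by linarith))
  have e8 := abs_le.1 (abs_mul_log_le_one (add_nonneg h10 h00) (by linarith))
  unfold mutualInfo
  rw [abs_le]
  constructor <;> linarith [e1.1, e1.2, e2.1, e2.2, e3.1, e3.2, e4.1, e4.2, e5.1, e5.2, e6.1,
    e6.2, e7.1, e7.2, e8.1, e8.2]

/-- `φ` is the leading part of `log Γ`. Cells, rows, columns and total all sum to `N` and enter with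
signs `+, -, -, +`, so the linear terms and the multiples of `log N` cancel. -/
lemma natCast_mul_mutualInfo_freq {N : ℕ} (hN : 0 < N) (x : Fin N → Bool × Bool) {φ : ℝ → ℝ}
    (hφ : ∀ s, φ s = s * Real.log s - s) :
    N * mutualInfo (freq x) =
      φ (count x (true, true)) + φ (count x (true, false)) + φ (count x (false, true)) +
        φ (count x (false, false)) - φ (count x (true, true) + count x (true, false)) -
        φ (count x (false, true) + count x (false, false)) -
        φ (count x (true, true) + count x (false, true)) -
        φ (count x (true, false) + count x (false, false)) + φ N := by
  have hN' : (0 : ℝ) < N := by exact_mod_cast hN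
  have h : ∀ s : ℝ, φ s = N * (s / N * Real.log (s / N)) + s * Real.log N - s := by
    intro s
    rw [hφ]
    by_cases hs : s = 0
    · simp [hs]
    · rw [Real.log_div hs hN'.ne']
      field_simp
      ring
  have hsum := sum_count x
  simp only [Fintype.sum_prod_type, Fintype.sum_bool] at hsum
  have hlast : φ N = N * Real.log N - N := hφ N
  rw [hlast]
  simp only [h, mutualInfo, freq, ← add_div]
  linear_combination (Real.log N - 1) * hsum

/-- The log ratio of the BDe marginal likelihoods in terms of the Gamma function. -/
theorem log_bde_ratio_eq {a : Fin 4 → ℝ} (ha : ∀ k, 0 < a k) {b₁ b₂ : ℝ} (hb₁ : 0 < b₁)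
    (hb₂ : 0 < b₂) {N : ℕ} (x : Fin N → Bool × Bool) {n₁ n₂ n₃ n₄ : ℕ}
    (e₁ : n₁ = count x (true, true)) (e₂ : n₂ = count x (true, false))
    (e₃ : n₃ = count x (false, true)) (e₄ : n₄ = count x (false, false)) :
    0 < bdeEdge a x ∧ 0 < bdeEmpty a b₁ b₂ x ∧
    Real.log (bdeEdge a x / bdeEmpty a b₁ b₂ x) =
      (Real.log (Real.Gamma (a 0 + a 1 + a 2 + a 3) /
        (Real.Gamma (a 0) * Real.Gamma (a 1) * Real.Gamma (a 2) * Real.Gamma (a 3))) +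
        Real.log (beta (a 0 + a 1) (a 2 + a 3)) + Real.log (beta b₁ b₂)) +
      (Real.log (Real.Gamma (a 0 + n₁)) + Real.log (Real.Gamma (a 1 + n₂)) +
        Real.log (Real.Gamma (a 2 + n₃)) + Real.log (Real.Gamma (a 3 + n₄)) -
        Real.log (Real.Gamma (a 0 + a 1 + (n₁ + n₂ : ℕ))) -
        Real.log (Real.Gamma (a 2 + a 3 + (n₃ + n₄ : ℕ))) -
        Real.log (Real.Gamma (b₁ + (n₁ + n₃ : ℕ))) - Real.log (Real.Gamma (b₂ + (n₂ + n₄ : ℕ))) +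
        Real.log (Real.Gamma (b₁ + b₂ + N))) := by
  have h0 := ha 0
  have h1 := ha 1
  have h2 := ha 2
  have h3 := ha 3
  have h01 := add_pos h0 h1
  have h23 := add_pos h2 h3
  have hb := add_pos hb₁ hb₂
  have hsum := sum_count x
  simp only [Fintype.sum_prod_type, Fintype.sum_bool] at hsum
  have hE := bdeEdge_eq ha x
  have hF := bdeEmpty_eq ha hb₁ hb₂ x
  rw [← e₁, ← e₂, ← e₃, ← e₄] at hsum hE hF
  have hB1 := beta_pos h01 h23
  have hB2 := beta_pos hb₁ hb₂
  have G : ∀ c : ℝ, 0 < c → ∀ n : ℕ, 0 < Real.Gamma (c + n) := fun c hc n =>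
    Real.Gamma_pos_of_pos (by positivity)
  have g0 := G _ h0 n₁
  have g1 := G _ h1 n₂
  have g2 := G _ h2 n₃
  have g3 := G _ h3 n₄
  have g4 := G _ h01 (n₁ + n₂)
  have g5 := G _ h23 (n₃ + n₄)
  have g6 := G _ hb₁ (n₁ + n₃)
  have g7 := G _ hb₂ (n₂ + n₄)
  have g8 := G _ hb N
  have g9 := G _ (add_pos (add_pos h01 h2) h3) N
  have hA := Real.Gamma_pos_of_pos (add_pos (add_pos h01 h2) h3)
  have hG0 := Real.Gamma_pos_of_pos h0
  have hG1 := Real.Gamma_pos_of_pos h1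
  have hG2 := Real.Gamma_pos_of_pos h2
  have hG3 := Real.Gamma_pos_of_pos h3
  -- The denominator is also that of the Dirichlet integral, so it cancels in the ratio. Of the
  -- total-count factors only `Γ(b₁ + b₂ + N)` remains.
  have hβ1 : beta (a 0 + a 1 + (n₁ + n₂ : ℕ)) (a 2 + a 3 + (n₃ + n₄ : ℕ)) =
      Real.Gamma (a 0 + a 1 + (n₁ + n₂ : ℕ)) * Real.Gamma (a 2 + a 3 + (n₃ + n₄ : ℕ)) /
        Real.Gamma (a 0 + a 1 + a 2 + a 3 + N) := by
    rw [beta]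
    congr 2
    rw [← hsum]
    push_cast
    ring
  have hβ2 : beta (b₁ + (n₁ + n₃ : ℕ)) (b₂ + (n₂ + n₄ : ℕ)) =
      Real.Gamma (b₁ + (n₁ + n₃ : ℕ)) * Real.Gamma (b₂ + (n₂ + n₄ : ℕ)) /
        Real.Gamma (b₁ + b₂ + N) := by
    rw [beta]
    congr 2
    rw [← hsum]
    push_cast
    ring
  rw [hβ1, hβ2] at hF
  have hEpos : 0 < bdeEdge a x := by
    rw [hE]
    positivity
  have hFpos : 0 < bdeEmpty a b₁ b₂ x := by
    rw [hF]
    positivity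
  refine ⟨hEpos, hFpos, ?_⟩
  rw [Real.log_div hEpos.ne' hFpos.ne', hE, hF]
  have hC := div_pos hA (mul_pos (mul_pos (mul_pos hG0 hG1) hG2) hG3)
  have hnum := mul_pos (mul_pos (mul_pos g0 g1) g2) g3
  rw [Real.log_mul hC.ne' (div_pos hnum g9).ne', Real.log_div hnum.ne' g9.ne',
    Real.log_mul (mul_pos (mul_pos g0 g1) g2).ne' g3.ne', Real.log_mul (mul_pos g0 g1).ne' g2.ne',
    Real.log_mul g0.ne' g1.ne', Real.log_mul (div_pos (div_pos (mul_pos g4 g5) g9) hB1).ne'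
      (div_pos (div_pos (mul_pos g6 g7) g8) hB2).ne',
    Real.log_div (div_pos (mul_pos g4 g5) g9).ne' hB1.ne', Real.log_div (mul_pos g4 g5).ne' g9.ne',
    Real.log_mul g4.ne' g5.ne', Real.log_div (div_pos (mul_pos g6 g7) g8).ne' hB2.ne',
    Real.log_div (mul_pos g6 g7).ne' g8.ne', Real.log_mul g6.ne' g7.ne']
  ring

/-- Up to a logarithmic error, the log ratio of the BDe marginal likelihoods is `N` times the
empirical mutual information. -/
theorem exists_abs_log_bde_ratio_sub_le {a : Fin 4 → ℝ} (ha : ∀ k, 0 < a k) {b₁ b₂ : ℝ}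
    (hb₁ : 0 < b₁) (hb₂ : 0 < b₂) :
    ∃ K, ∀ N : ℕ, 0 < N → ∀ x : Fin N → Bool × Bool,
      0 < bdeEdge a x ∧ 0 < bdeEmpty a b₁ b₂ x ∧
      |Real.log (bdeEdge a x / bdeEmpty a b₁ b₂ x) - N * mutualInfo (freq x)| ≤
        K * (1 + Real.log (1 + N)) := by
  obtain ⟨K₀, hK₀, k₀⟩ := abs_log_Gamma_sub_le (ha 0)
  obtain ⟨K₁, hK₁, k₁⟩ := abs_log_Gamma_sub_le (ha 1)
  obtain ⟨K₂, hK₂, k₂⟩ := abs_log_Gamma_sub_le (ha 2)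
  obtain ⟨K₃, hK₃, k₃⟩ := abs_log_Gamma_sub_le (ha 3)
  obtain ⟨K₄, hK₄, k₄⟩ := abs_log_Gamma_sub_le (add_pos (ha 0) (ha 1))
  obtain ⟨K₅, hK₅, k₅⟩ := abs_log_Gamma_sub_le (add_pos (ha 2) (ha 3))
  obtain ⟨K₆, hK₆, k₆⟩ := abs_log_Gamma_sub_le hb₁
  obtain ⟨K₇, hK₇, k₇⟩ := abs_log_Gamma_sub_le hb₂
  obtain ⟨K₈, hK₈, k₈⟩ := abs_log_Gamma_sub_le (add_pos hb₁ hb₂)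
  obtain ⟨C, hC⟩ : ∃ C, C = Real.log (Real.Gamma (a 0 + a 1 + a 2 + a 3) /
      (Real.Gamma (a 0) * Real.Gamma (a 1) * Real.Gamma (a 2) * Real.Gamma (a 3))) +
      Real.log (beta (a 0 + a 1) (a 2 + a 3)) + Real.log (beta b₁ b₂) := ⟨_, rfl⟩
  refine ⟨|C| + K₀ + K₁ + K₂ + K₃ + K₄ + K₅ + K₆ + K₇ + K₈, fun N hN x => ?_⟩
  have hsum := sum_count x
  simp only [Fintype.sum_prod_type, Fintype.sum_bool] at hsum
  obtain ⟨n₁, e₁⟩ : ∃ n, n = count x (true, true) := ⟨_, rfl⟩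
  obtain ⟨n₂, e₂⟩ : ∃ n, n = count x (true, false) := ⟨_, rfl⟩
  obtain ⟨n₃, e₃⟩ : ∃ n, n = count x (false, true) := ⟨_, rfl⟩
  obtain ⟨n₄, e₄⟩ : ∃ n, n = count x (false, false) := ⟨_, rfl⟩
  obtain ⟨hE, hF, hlog⟩ := log_bde_ratio_eq ha hb₁ hb₂ x e₁ e₂ e₃ e₄
  obtain ⟨φ, hφ⟩ : ∃ φ : ℝ → ℝ, ∀ s, φ s = s * Real.log s - s := ⟨_, fun _ => rfl⟩
  have hlin := natCast_mul_mutualInfo_freq hN x hφ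
  rw [← e₁, ← e₂, ← e₃, ← e₄] at hsum hlin
  have hsum' : n₁ + n₂ + (n₃ + n₄) = N := by exact_mod_cast hsum
  refine ⟨hE, hF, ?_⟩
  rw [hlog, hlin, ← hC]
  have mono : ∀ (K : ℝ) (n : ℕ), 0 ≤ K → n ≤ N →
      K * (1 + Real.log (n + 1)) ≤ K * (1 + Real.log (1 + N)) := by
    intro K n hK hn
    have : (n : ℝ) ≤ N := by exact_mod_cast hn
    have h : Real.log ((n : ℝ) + 1) ≤ Real.log (1 + N) :=
      Real.log_le_log (by positivity) (by linarith)
    exact mul_le_mul_of_nonneg_left (by linarith) hK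
  simp only [← hφ] at k₀ k₁ k₂ k₃ k₄ k₅ k₆ k₇ k₈
  have l0 := abs_le.1 ((k₀ n₁).trans (mono _ _ hK₀ (by omega)))
  have l1 := abs_le.1 ((k₁ n₂).trans (mono _ _ hK₁ (by omega)))
  have l2 := abs_le.1 ((k₂ n₃).trans (mono _ _ hK₂ (by omega)))
  have l3 := abs_le.1 ((k₃ n₄).trans (mono _ _ hK₃ (by omega)))
  have l4 := abs_le.1 ((k₄ (n₁ + n₂)).trans (mono _ _ hK₄ (by omega)))
  have l5 := abs_le.1 ((k₅ (n₃ + n₄)).trans (mono _ _ hK₅ (by omega)))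
  have l6 := abs_le.1 ((k₆ (n₁ + n₃)).trans (mono _ _ hK₆ (by omega)))
  have l7 := abs_le.1 ((k₇ (n₂ + n₄)).trans (mono _ _ hK₇ (by omega)))
  have l8 := abs_le.1 ((k₈ N).trans (mono _ _ hK₈ le_rfl))
  have hL : 0 ≤ Real.log (1 + (N : ℝ)) :=
    Real.log_nonneg (by linarith [(Nat.cast_nonneg N : (0 : ℝ) ≤ N)])
  generalize Real.log (1 + (N : ℝ)) = L at *
  have lC := abs_le.1 (show |C| ≤ |C| * (1 + L) by
    nlinarith [abs_nonneg C, mul_nonneg (abs_nonneg C) hL])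
  simp only [← Nat.cast_add]
  simp only [add_mul _ _ (1 + L)]
  clear mono k₀ k₁ k₂ k₃ k₄ k₅ k₆ k₇ k₈ hlog hlin hE hF hC
  rw [abs_le]
  constructor
  · linarith only [l0.1, l1.1, l2.1, l3.1, l4.2, l5.2, l6.2, l7.2, l8.1, lC.1]
  · linarith only [l0.2, l1.2, l2.2, l3.2, l4.1, l5.1, l6.1, l7.1, l8.2, lC.2]

/-- A zero cell annihilates its term, while a positive cell forces both of its margins to be
positive, so each logarithm splits in either case. -/
lemma mutualInfo_eq {f : Bool × Bool → ℝ} (hf : ∀ c, 0 ≤ f c) {p11 p10 p01 p00 : ℝ}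
    (h11 : f (true, true) = p11) (h10 : f (true, false) = p10) (h01 : f (false, true) = p01)
    (h00 : f (false, false) = p00) :
    mutualInfo f = p11 * Real.log (p11 / ((p11 + p10) * (p11 + p01))) +
      p10 * Real.log (p10 / ((p11 + p10) * (p10 + p00))) +
      p01 * Real.log (p01 / ((p01 + p00) * (p11 + p01))) +
      p00 * Real.log (p00 / ((p01 + p00) * (p10 + p00))) := by
  have key : ∀ s u v : ℝ, 0 ≤ s → s ≤ u → s ≤ v →
      s * Real.log (s / (u * v)) = s * Real.log s - s * Real.log u - s * Real.log v := by
    intro s u v hs hu hv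
    rcases hs.eq_or_lt with h | h
    · simp [← h]
    · have hu' := h.trans_le hu
      have hv' := h.trans_le hv
      rw [Real.log_div h.ne' (by positivity), Real.log_mul hu'.ne' hv'.ne']
      ring
  have g11 := h11 ▸ hf (true, true)
  have g10 := h10 ▸ hf (true, false)
  have g01 := h01 ▸ hf (false, true)
  have g00 := h00 ▸ hf (false, false)
  rw [key p11 _ _ g11 (by linarith) (by linarith), key p10 _ _ g10 (by linarith) (by linarith),
    key p01 _ _ g01 (by linarith) (by linarith), key p00 _ _ g00 (by linarith) (by linarith),
    mutualInfo, h11, h10, h01, h00]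
  ring

lemma tendsto_log_one_add_div (K : ℝ) :
    Tendsto (fun N : ℕ => (K * (1 + Real.log (1 + N))) / N) atTop (𝓝 0) := by
  have h := ((tendsto_const_div_atTop_nhds_zero_nat (1 : ℝ)).add
    (tendsto_log_add_div (c := 1))).const_mul K
  rw [add_zero, mul_zero] at h
  refine h.congr fun N => ?_
  ring

lemma meanLogPosteriorRatio_eq_integral (Q : Measure (Bool × Bool)) (q : ℝ)
    (L₁ L₀ : ∀ N : ℕ, (Fin N → Bool × Bool) → ℝ) (N : ℕ) :
    meanLogPosteriorRatio Q q L₁ L₀ N =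
      ∫ x, 1 / (N : ℝ) * Real.log (posteriorEdge q (L₁ N x) (L₀ N x) /
        posteriorEmpty q (L₁ N x) (L₀ N x)) ∂(Measure.pi fun _ : Fin N => Q) := by
  rw [meanLogPosteriorRatio, integral_const_mul]

lemma abs_mean_log_sub_le {N : ℕ} (hN : 0 < N) {q m₁ m₀ z E : ℝ} (hq0 : 0 < q) (hq1 : q < 1)
    (h₁ : 0 < m₁) (h₀ : 0 < m₀) (h : |Real.log (m₁ / m₀) - N * z| ≤ E) :
    |1 / (N : ℝ) * Real.log (posteriorEdge q m₁ m₀ / posteriorEmpty q m₁ m₀) - z| ≤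
      (E + |Real.log (q / (1 - q))|) / N := by
  have hN' : (0 : ℝ) < N := by exact_mod_cast hN
  rw [log_posterior_ratio hq0 hq1 h₁ h₀, show 1 / (N : ℝ) * (Real.log (m₁ / m₀) +
    Real.log (q / (1 - q))) - z = ((Real.log (m₁ / m₀) - N * z) + Real.log (q / (1 - q))) / N by
      field_simp; ring, abs_div, abs_of_pos hN']
  gcongr
  exact (abs_add_le _ _).trans (by linarith)

theorem tendsto_discRatio (p β : unitInterval) {q : ℝ} (hq0 : 0 < q) (hq1 : q < 1)
    {a : Fin 4 → ℝ} (ha : ∀ k, 0 < a k) {b₁ b₂ : ℝ} (hb₁ : 0 < b₁) (hb₂ : 0 < b₂) :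
    Tendsto (discRatio p β q a b₁ b₂) atTop
      (𝓝 (mutualInfo fun c => (sddLaw p β).real {c})) := by
  obtain ⟨K, hK⟩ := exists_abs_log_bde_ratio_sub_le ha hb₁ hb₂
  have h := tendsto_integral_of_freq (sddLaw p β)
    (F := fun N x => 1 / (N : ℝ) * Real.log (posteriorEdge q (bdeEdge a x) (bdeEmpty a b₁ b₂ x) /
        posteriorEmpty q (bdeEdge a x) (bdeEmpty a b₁ b₂ x)))
    (Φ := fun _ f => mutualInfo f) (B := fun _ => 8)
    (e := fun N => (K * (1 + Real.log (1 + N)) + |Real.log (q / (1 - q))|) / N)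
    ((continuous_mutualInfo.tendsto _).comp (tendsto_snd.mono_right nhdsWithin_le_nhds))
    (by
      filter_upwards [eventually_gt_atTop 0] with N hN x
      exact abs_mutualInfo_freq_le hN x)
    (tendsto_const_div_atTop_nhds_zero_nat 8)
    (by
      filter_upwards [eventually_gt_atTop 0] with N hN x
      obtain ⟨h1, h0, h2⟩ := hK N hN x
      exact abs_mean_log_sub_le hN hq0 hq1 h1 h0 h2)
    (by
      simp_rw [add_div]
      simpa using (tendsto_log_one_add_div K).add (tendsto_const_div_atTop_nhds_zero_nat _))
  refine h.congr fun N => ?_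
  rw [discRatio, meanLogPosteriorRatio_eq_integral]

/-! ### The BGe score: limits -/

/-- The function of the empirical frequencies that governs the BGe score. -/
noncomputable def ragLimit (am t : ℝ) (N : ℕ) (f : Bool × Bool → ℝ) : ℝ :=
  1 / 2 * tableCorr (t * (1 / N)) (f (true, true)) (f (true, false)) (f (false, true))
    (f (false, false) + am * (1 / N))

/-- These bounds do not involve the true law, so they serve the convergent and the divergent case
alike. -/
lemma exists_rag_bounds {q am aw t : ℝ} (hq0 : 0 < q) (hq1 : q < 1) (ham : 0 < am)
    (haw : 3 < aw) (ht : 0 < t) :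
    ∃ B e : ℕ → ℝ, Tendsto (fun N => B N / N) atTop (𝓝 0) ∧ Tendsto e atTop (𝓝 0) ∧
      (∀ᶠ N in atTop, ∀ x : Fin N → Bool × Bool, |ragLimit am t N (freq x)| ≤ B N) ∧
      ∀ᶠ N in atTop, ∀ x : Fin N → Bool × Bool,
        |1 / (N : ℝ) * Real.log
          (posteriorEdge q (bgeEdge am aw t (asReal x)) (bgeEmpty am aw t (asReal x)) /
          posteriorEmpty q (bgeEdge am aw t (asReal x)) (bgeEmpty am aw t (asReal x))) -
          ragLimit am t N (freq x)| ≤ e N := by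
  obtain ⟨K, hK⟩ := exists_abs_log_bge_ratio_sub_le ham haw ht
  have hlog : ∀ c : ℝ, Tendsto (fun N : ℕ => |Real.log (c + N)| / N) atTop (𝓝 0) := fun c => by
    have := (tendsto_log_add_div (c := c)).abs
    rw [abs_zero] at this
    refine this.congr fun N => ?_
    rw [abs_div, Nat.abs_cast]
  have hconst : ∀ c : ℝ, Tendsto (fun N : ℕ => c / N) atTop (𝓝 0) :=
    fun c => tendsto_const_div_atTop_nhds_zero_nat c
  have hcorr : ∀ N : ℕ, 2 ≤ N → ∀ x : Fin N → Bool × Bool, ragLimit am t N (freq x) =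
      1 / 2 * tableCorr t (count x (true, true)) (count x (true, false))
          (count x (false, true)) (count x (false, false) + am) := by
    intro N hN x
    have hN' : (0 : ℝ) < N := by exact_mod_cast (by omega : 0 < N)
    rw [ragLimit, ← tableCorr_smul (t := t) (k := 1 / (N : ℝ)) (by positivity)]
    simp only [freq]
    congr 2 <;> ring
  refine ⟨fun N => |Real.log (t + N)| + |Real.log t|,
    fun N => ((K + |Real.log (aw + N)| + (aw + 1) * |Real.log (t + N)|) +
      |Real.log (q / (1 - q))|) / N, ?_, ?_, ?_, ?_⟩
  · simp_rw [add_div]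
    simpa using (hlog t).add (hconst |Real.log t|)
  · simp_rw [add_div, mul_div_assoc]
    simpa using (((hconst K).add (hlog aw)).add ((hlog t).const_mul (aw + 1))).add
      (hconst |Real.log (q / (1 - q))|)
  · filter_upwards [eventually_ge_atTop 2] with N hN x
    obtain ⟨-, -, -, h⟩ := hK N hN x
    rw [hcorr N hN x, abs_mul, abs_of_pos (by norm_num : (0 : ℝ) < 1 / 2)]
    linarith
  · filter_upwards [eventually_ge_atTop 2] with N hN x
    obtain ⟨h1, h0, h, -⟩ := hK N hN x
    refine abs_mean_log_sub_le (by omega) hq0 hq1 h1 h0 ?_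
    rw [hcorr N hN x, ← mul_assoc, mul_one_div]
    exact h

lemma ragRatio_eq_integral (p β : unitInterval) (q am aw t : ℝ) (N : ℕ) :
    ragRatio p β q am aw t N = ∫ x, 1 / (N : ℝ) * Real.log
        (posteriorEdge q (bgeEdge am aw t (asReal x)) (bgeEmpty am aw t (asReal x)) /
        posteriorEmpty q (bgeEdge am aw t (asReal x)) (bgeEmpty am aw t (asReal x)))
      ∂(Measure.pi fun _ : Fin N => sddLaw p β) := by
  rw [ragRatio, meanLogPosteriorRatio_eq_integral]

theorem tendsto_ragRatio (p β : unitInterval) {q am aw t : ℝ} (hq0 : 0 < q) (hq1 : q < 1)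
    (ham : 0 < am) (haw : 3 < aw) (ht : 0 < t) (hβ : (β : ℝ) < 1) :
    Tendsto (ragRatio p β q am aw t) atTop
      (𝓝 (1 / 2 * Real.log ((1 - (2 * (p : ℝ) - 1) ^ 2 * (β : ℝ) ^ 2) / (1 - (β : ℝ) ^ 2)))) := by
  obtain ⟨B, e, hB0, he, hB, hF⟩ := exists_rag_bounds hq0 hq1 ham haw ht
  simp_rw [funext (ragRatio_eq_integral p β q am aw t)]
  refine tendsto_integral_of_freq (sddLaw p β) (Φ := ragLimit am t) ?_ hB hB0 hF he
  obtain ⟨h11, h10, h01, h00⟩ := sddLaw_singleton p β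
  have hp0 := p.2.1
  have hp1 := p.2.2
  have hβ0 := β.2.1
  have hβ2 : 0 < 1 - (β : ℝ) ^ 2 := by nlinarith
  have hfreq : ∀ c, Tendsto (fun z : ℕ × (Bool × Bool → ℝ) => z.2 c)
      (atTop ×ˢ 𝓝[freqSupport (sddLaw p β)] (fun c => (sddLaw p β).real {c}))
      (𝓝 ((sddLaw p β).real {c})) := fun c =>
    ((continuous_apply c).tendsto _).comp (tendsto_snd.mono_right nhdsWithin_le_nhds)
  have he : Tendsto (fun z : ℕ × (Bool × Bool → ℝ) => 1 / (z.1 : ℝ))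
      (atTop ×ˢ 𝓝[freqSupport (sddLaw p β)] (fun c => (sddLaw p β).real {c})) (𝓝 0) :=
    tendsto_one_div_atTop_nhds_zero_nat.comp tendsto_fst
  have f11 := hfreq (true, true)
  have f10 := hfreq (true, false)
  have f01 := hfreq (false, true)
  have f00 := hfreq (false, false)
  have hsupp : ∀ᶠ z : ℕ × (Bool × Bool → ℝ) in
      atTop ×ˢ 𝓝[freqSupport (sddLaw p β)] (fun c => (sddLaw p β).real {c}),
      z.2 ∈ freqSupport (sddLaw p β) := tendsto_snd.eventually self_mem_nhdsWithin
  have hpos : ∀ᶠ z : ℕ × (Bool × Bool → ℝ) in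
      atTop ×ˢ 𝓝[freqSupport (sddLaw p β)] (fun c => (sddLaw p β).real {c}),
      1 / (z.1 : ℝ) ≠ 0 := by
    filter_upwards [tendsto_fst.eventually (eventually_gt_atTop 0)] with z hz
    have : (0 : ℝ) < z.1 := by exact_mod_cast hz
    positivity
  rw [h11] at f11
  rw [h10] at f10
  rw [h01] at f01
  rw [h00] at f00
  unfold ragLimit
  refine Tendsto.const_mul (1 / 2) ?_
  have hv : ((p : ℝ) * (1 / 2 + (β : ℝ) / 2) + (1 - (p : ℝ)) * (1 / 2 - (β : ℝ) / 2)) *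
      ((p : ℝ) * (1 / 2 - (β : ℝ) / 2) + (1 - (p : ℝ)) * (1 / 2 + (β : ℝ) / 2)) =
      (1 - (2 * (p : ℝ) - 1) ^ 2 * (β : ℝ) ^ 2) / 4 := by ring
  by_cases hp : 0 < (p : ℝ) ∧ (p : ℝ) < 1
  · have hpp : 0 < (p : ℝ) * (1 - p) := mul_pos hp.1 (by linarith [hp.2])
    -- The determinant of the true covariance matrix is `p (1 - p) (1 - β²) / 4`; the factor `p (1 -
    -- p) / 4` also occurs in the product of the variances and cancels.
    have hdet : ((p : ℝ) * (1 / 2 + (β : ℝ) / 2) + (p : ℝ) * (1 / 2 - (β : ℝ) / 2)) *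
        ((1 - (p : ℝ)) * (1 / 2 - (β : ℝ) / 2) + (1 - (p : ℝ)) * (1 / 2 + (β : ℝ) / 2)) *
        (((p : ℝ) * (1 / 2 + (β : ℝ) / 2) + (1 - (p : ℝ)) * (1 / 2 - (β : ℝ) / 2)) *
        ((p : ℝ) * (1 / 2 - (β : ℝ) / 2) + (1 - (p : ℝ)) * (1 / 2 + (β : ℝ) / 2))) -
        ((p : ℝ) * (1 / 2 + (β : ℝ) / 2) * ((1 - (p : ℝ)) * (1 / 2 + (β : ℝ) / 2)) -
          (p : ℝ) * (1 / 2 - (β : ℝ) / 2) * ((1 - (p : ℝ)) * (1 / 2 - (β : ℝ) / 2))) ^ 2 =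
        (p : ℝ) * (1 - p) / 4 * (1 - (β : ℝ) ^ 2) := by ring
    have h := tendsto_tableCorr_of_pos (t := t) (am := am) he f11 f10 f01 f00 (by ring)
      (by rw [hdet]; positivity)
    rw [hdet, hv, show ((p : ℝ) * (1 / 2 + (β : ℝ) / 2) + (p : ℝ) * (1 / 2 - (β : ℝ) / 2)) *
        ((1 - (p : ℝ)) * (1 / 2 - (β : ℝ) / 2) + (1 - (p : ℝ)) * (1 / 2 + (β : ℝ) / 2)) *
        ((1 - (2 * (p : ℝ) - 1) ^ 2 * (β : ℝ) ^ 2) / 4) =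
        (p : ℝ) * (1 - p) / 4 * (1 - (2 * (p : ℝ) - 1) ^ 2 * (β : ℝ) ^ 2) by ring,
      mul_div_mul_left _ _ (by positivity)] at h
    exact h
  -- Here `X₁` is constant and the claimed limit is `log 1 = 0`. The true covariance matrix is
  -- singular, so continuity alone does not decide the limit.
  · have hp' : (p : ℝ) = 0 ∨ (p : ℝ) = 1 := by
      by_contra hcon
      push Not at hcon
      exact hp ⟨lt_of_le_of_ne hp0 (Ne.symm hcon.1), lt_of_le_of_ne hp1 hcon.2⟩
    have hsq : (2 * (p : ℝ) - 1) ^ 2 = 1 := by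
      rcases hp' with h | h <;> rw [h] <;> norm_num
    rw [hsq, one_mul] at hv ⊢
    rw [div_self hβ2.ne', Real.log_one]
    refine tendsto_tableCorr_of_degenerate ht ham he f11 f10 f01 f00 (by ring) (by linarith)
      (by rw [hv]; positivity) hpos ?_
    rcases hp' with h | h
    · left
      filter_upwards [hsupp] with z hz
      exact ⟨(hz _).2 (by rw [h11, h, zero_mul]), (hz _).2 (by rw [h10, h, zero_mul])⟩
    · right
      filter_upwards [hsupp] with z hz
      exact ⟨(hz _).2 (by rw [h01, h, sub_self, zero_mul]),
        (hz _).2 (by rw [h00, h, sub_self, zero_mul])⟩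

theorem tendsto_ragRatio_atTop (p β : unitInterval) {q am aw t : ℝ} (hq0 : 0 < q) (hq1 : q < 1)
    (ham : 0 < am) (haw : 3 < aw) (ht : 0 < t) (hβ : (β : ℝ) = 1) (hp0 : 0 < (p : ℝ))
    (hp1 : (p : ℝ) < 1) :
    Tendsto (ragRatio p β q am aw t) atTop atTop := by
  obtain ⟨B, e, hB0, he, hB, hF⟩ := exists_rag_bounds hq0 hq1 ham haw ht
  simp_rw [funext (ragRatio_eq_integral p β q am aw t)]
  refine tendsto_integral_atTop_of_freq (sddLaw p β) (Φ := ragLimit am t) ?_ hB hB0 hF he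
  obtain ⟨h11, h10, h01, h00⟩ := sddLaw_singleton p β
  have hfreq : ∀ c, Tendsto (fun z : ℕ × (Bool × Bool → ℝ) => z.2 c)
      (atTop ×ˢ 𝓝[freqSupport (sddLaw p β)] (fun c => (sddLaw p β).real {c}))
      (𝓝 ((sddLaw p β).real {c})) := fun c =>
    ((continuous_apply c).tendsto _).comp (tendsto_snd.mono_right nhdsWithin_le_nhds)
  have he : Tendsto (fun z : ℕ × (Bool × Bool → ℝ) => 1 / (z.1 : ℝ))
      (atTop ×ˢ 𝓝[freqSupport (sddLaw p β)] (fun c => (sddLaw p β).real {c})) (𝓝 0) :=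
    tendsto_one_div_atTop_nhds_zero_nat.comp tendsto_fst
  have f11 := hfreq (true, true)
  have f10 := hfreq (true, false)
  have f01 := hfreq (false, true)
  have f00 := hfreq (false, false)
  rw [h11, hβ] at f11
  rw [h10, hβ] at f10
  rw [h01, hβ] at f01
  rw [h00, hβ] at f00
  have hpp : 0 < (p : ℝ) * (1 - p) := mul_pos hp0 (by linarith)
  unfold ragLimit
  refine Tendsto.const_mul_atTop (by norm_num) (tendsto_tableCorr_atTop ht ham he f11 f10 f01 f00
    (by ring) (by ring) ?_ ?_)
  -- For `β = 1` the variables coincide, so both variances are `p (1 - p)`: their product is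
  -- positive while the determinant vanishes.
  · have : 0 < ((p : ℝ) * (1 - p)) ^ 2 := by positivity
    refine this.trans_eq ?_
    ring
  · filter_upwards [tendsto_fst.eventually (eventually_gt_atTop 0),
      tendsto_snd.eventually self_mem_nhdsWithin] with z hz hz'
    have : (0 : ℝ) < z.1 := by exact_mod_cast hz
    exact ⟨by positivity, (hz' _).1, (hz' _).1, (hz' _).1, (hz' _).1⟩

end TwoNode

theorem theorem4 (p β : unitInterval)
    -- prior probability of the graph with an edge
    (q : ℝ) (hq0 : 0 < q) (hq1 : q < 1)
    -- hyperparameters of the normal-Wishart prior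
    (am aw t : ℝ) (ham : 0 < am) (haw : 3 < aw) (ht : 0 < t)
    -- hyperparameters of the Dirichlet prior, and of the prior of the second variable without edge
    (a : Fin 4 → ℝ) (ha : ∀ k, 0 < a k) (b₁ b₂ : ℝ) (hb₁ : 0 < b₁) (hb₂ : 0 < b₂)
    -- cell probabilities and their margins
    (p11 p10 p01 p00 : ℝ)
    (h11 : p11 = (p : ℝ) * (1 / 2 + (β : ℝ) / 2)) (h10 : p10 = (p : ℝ) * (1 / 2 - (β : ℝ) / 2))
    (h01 : p01 = (1 - (p : ℝ)) * (1 / 2 - (β : ℝ) / 2))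
    (h00 : p00 = (1 - (p : ℝ)) * (1 / 2 + (β : ℝ) / 2))
    (p1x p0x px1 px0 : ℝ) (h1x : p1x = p11 + p10) (h0x : p0x = p01 + p00)
    (hx1 : px1 = p11 + p01) (hx0 : px0 = p10 + p00) :
    ((β : ℝ) < 1 →
      Tendsto (TwoNode.ragRatio p β q am aw t) atTop
        (𝓝 (1 / 2 * Real.log
          ((1 - (2 * (p : ℝ) - 1) ^ 2 * (β : ℝ) ^ 2) / (1 - (β : ℝ) ^ 2))))) ∧
    ((β : ℝ) = 1 → 0 < (p : ℝ) → (p : ℝ) < 1 →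
      Tendsto (TwoNode.ragRatio p β q am aw t) atTop atTop) ∧
    Tendsto (TwoNode.discRatio p β q a b₁ b₂) atTop
      (𝓝 (p11 * Real.log (p11 / (p1x * px1)) + p10 * Real.log (p10 / (p1x * px0)) +
        p01 * Real.log (p01 / (p0x * px1)) + p00 * Real.log (p00 / (p0x * px0)))) := by
  obtain ⟨g11, g10, g01, g00⟩ := TwoNode.sddLaw_singleton p β
  rw [← h11] at g11
  rw [← h10] at g10
  rw [← h01] at g01
  rw [← h00] at g00
  refine ⟨TwoNode.tendsto_ragRatio p β hq0 hq1 ham haw ht,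
    TwoNode.tendsto_ragRatio_atTop p β hq0 hq1 ham haw ht, ?_⟩
  have h := TwoNode.tendsto_discRatio p β hq0 hq1 ha hb₁ hb₂
  rw [TwoNode.mutualInfo_eq (fun _ => measureReal_nonneg) g11 g10 g01 g00] at h
  rw [h1x, h0x, hx1, hx0]
  exact h
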